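/- Let $\varphi: M^2\to\mathbb R^3$ be a smooth immersion of an oriented surface, with induced metric $g=\langle\,,\rangle$, unit normal field $\eta$ (compatible with the orientation), second fundamental form $B$, shape operator $A$ (so $d\varphi(A v)=-d\eta(v)$ and $B(v,w)=\langle Av,w\rangle\,\eta$), mean curvature function $f=\tfrac12\operatorname{trace}A$ and mean curvature vector field $H=f\eta$. Assume that $M$ is flat, i.e. its Gaussian curvature vanishes identically, and that $f>0$ and $|\operatorname{grad} f|>0$ everywhere on $M$. For positively oriented local isothermal coordinates $(x,y)$ on $M$ put $z=x+\mathrm i y$, $\partial_z=\tfrac12(\partial_x-\mathrm i\,\partial_y)$ and $Q(z,\bar z)=\langle B(\partial_z,\partial_z),H\rangle$, where $\langle B(\cdot,\cdot),H\rangle$ is extended complex bilinearly. Suppose that $Q$ is holomorphic, i.e. in all positively oriented local isothermal coordinates $Q(z,\bar z)$ is a holomorphic function of $z$. Then, locally and up to an isometry of $\mathbb R^3$, the surface can be parametrized by $$X(u,v)=\Big(\tfrac1k(1-\alpha v)\cos(ku),\ \tfrac1k(1-\alpha v)\sin(ku),\ \beta v\Big),$$ where $\alpha,k,\beta$ are real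 constants with $\alpha^2+k^2\beta^2=k^2$ and $\alpha\ne0$. That is, for every $p\in M$ there are such constants, an isometry $T$ of $\mathbb R^3$, and smooth local coordinates $(u,v)$ on a neighbourhood of $p$ in which $\varphi=T\circ X(u,v)$. -/

import Mathlib

open scoped Manifold ContDiff

noncomputable section

namespace FlatSurface

/-- The coordinate plane `ℝ²`. -/
abbrev Plane : Type := EuclideanSpace ℝ (Fin 2)

/-- Euclidean space `ℝ³`. -/
abbrev Space : Type := EuclideanSpace ℝ (Fin 3)

section Surface

variable {M : Type*} [TopologicalSpace M] [ChartedSpace Plane M]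

/-- The differential at `p` of an `ℝ³`-valued map on the surface `M`. -/
def diff (F : M → Space) (p : M) : TangentSpace (𝓡 2) p →L[ℝ] Space :=
  mfderiv (𝓡 2) 𝓘(ℝ, Space) F p

/-- A smooth immersion of `M` into `ℝ³`. -/
structure IsSmoothImmersion (φ : M → Space) : Prop where
  smooth : ContMDiff (𝓡 2) 𝓘(ℝ, Space) ∞ φ
  injective_diff : ∀ p, Function.Injective (diff φ p)

/-- `η` is a (global, smooth) unit normal field along `φ`. For a surface in `ℝ³` an orientation
is the same thing as the choice of such a field: a frame `(v, w)` is positive if and only if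
`det (dφ v, dφ w, η) > 0`. -/
structure IsUnitNormal (φ η : M → Space) : Prop where
  smooth : ContMDiff (𝓡 2) 𝓘(ℝ, Space) ∞ η
  norm_eq_one : ∀ p, ‖η p‖ = 1
  normal : ∀ p v, inner ℝ (diff φ p v) (η p) = 0

/-- The induced metric `g = φ^* ⟨ , ⟩`. -/
def metric (φ : M → Space) (p : M) (v w : TangentSpace (𝓡 2) p) : ℝ :=
  inner ℝ (diff φ p v) (diff φ p w)

/-- `⟨A v, w⟩`, where `A` is the shape operator, given by `dφ (A v) = - dη v`. -/
def shapeForm (φ η : M → Space) (p : M) (v w : TangentSpace (𝓡 2) p) : ℝ :=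
  - inner ℝ (diff η p v) (diff φ p w)

/-- The (normal valued) second fundamental form `B(v, w) = ⟨A v, w⟩ η`. -/
def secondForm (φ η : M → Space) (p : M) (v w : TangentSpace (𝓡 2) p) : Space :=
  shapeForm φ η p v w • η p

/-- The standard basis of the tangent space `T_p M`, which in Mathlib is the model space `ℝ²`. -/
def stdVec (p : M) (i : Fin 2) : TangentSpace (𝓡 2) p :=
  (EuclideanSpace.single i (1 : ℝ) : Plane)

/-- The Gram matrix of the induced metric. -/
def metricMatrix (φ : M → Space) (p : M) : Matrix (Fin 2) (Fin 2) ℝ :=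
  Matrix.of fun i j => metric φ p (stdVec p i) (stdVec p j)

/-- The matrix of the shape operator `A` in the standard basis of `T_p M`. -/
def shapeMatrix (φ η : M → Space) (p : M) : Matrix (Fin 2) (Fin 2) ℝ :=
  (metricMatrix φ p)⁻¹ * Matrix.of fun i j => shapeForm φ η p (stdVec p j) (stdVec p i)

/-- The mean curvature function `f = (1/2) trace A`. -/
def meanCurvature (φ η : M → Space) (p : M) : ℝ :=
  (shapeMatrix φ η p).trace / 2

/-- The mean curvature vector field `H = f η`. -/
def meanCurvatureVector (φ η : M → Space) (p : M) : Space :=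
  meanCurvature φ η p • η p

/-- The Gaussian curvature `K = det A` of a surface in `ℝ³`. -/
def gaussCurvature (φ η : M → Space) (p : M) : ℝ :=
  (shapeMatrix φ η p).det

/-- The gradient of a function `f` with respect to the induced metric; its components are
`g^{ij} ∂_j f`. -/
def grad (φ : M → Space) (f : M → ℝ) (p : M) : TangentSpace (𝓡 2) p :=
  ∑ i, ((metricMatrix φ p)⁻¹.mulVec
    fun j => (mfderiv (𝓡 2) 𝓘(ℝ, ℝ) f p (stdVec p j) : ℝ)) i • stdVec p i

/-- The length `|grad f|` in the induced metric. -/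
def gradNorm (φ : M → Space) (f : M → ℝ) (p : M) : ℝ :=
  Real.sqrt (metric φ p (grad φ f p) (grad φ f p))

/-- The coordinate vector fields `∂_x` (`i = 0`) and `∂_y` (`i = 1`) of a chart `e = (x, y)`,
at the point with coordinates `a`. -/
def coordVec (e : OpenPartialHomeomorph M Plane) (a : Plane) (i : Fin 2) :
    TangentSpace (𝓡 2) (e.symm a) :=
  mfderiv (𝓡 2) (𝓡 2) e.symm a (EuclideanSpace.single i (1 : ℝ) : Plane)

/-- `e = (x, y)` is a positively oriented isothermal coordinate system on its domain:
`g = λ² (dx² + dy²)` with `λ > 0`, and `(∂_x, ∂_y)` is a positive frame. -/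
structure IsIsothermal (φ η : M → Space) (e : OpenPartialHomeomorph M Plane) : Prop where
  mem_maximalAtlas : e ∈ IsManifold.maximalAtlas (𝓡 2) ∞ M
  conformal : ∀ a ∈ e.target, ∃ l : ℝ, 0 < l ∧ ∀ i j,
    metric φ (e.symm a) (coordVec e a i) (coordVec e a j) = if i = j then l ^ 2 else 0
  oriented : ∀ a ∈ e.target,
    0 < (Matrix.of ![(diff φ (e.symm a) (coordVec e a 0)).ofLp,
      (diff φ (e.symm a) (coordVec e a 1)).ofLp, (η (e.symm a)).ofLp]).det

/-- The function `Q(z, z̄) = ⟨B(∂_z, ∂_z), H⟩`, `z = x + i y`, `∂_z = (∂_x - i ∂_y) / 2`, in the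
coordinates `e = (x, y)`; the real bilinear form `⟨B( , ), H⟩` is extended complex bilinearly. -/
def hopfQ (φ η : M → Space) (e : OpenPartialHomeomorph M Plane) (z : ℂ) : ℂ :=
  let a : Plane := !₂[z.re, z.im]
  let b : Fin 2 → Fin 2 → ℂ := fun i j =>
    ((inner ℝ (secondForm φ η (e.symm a) (coordVec e a i) (coordVec e a j))
      (meanCurvatureVector φ η (e.symm a)) : ℝ) : ℂ)
  (b 0 0 - Complex.I * b 0 1 - Complex.I * b 1 0 + Complex.I ^ 2 * b 1 1) / 4

/-- `Q` is holomorphic: in all positively oriented isothermal coordinates it is a holomorphic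
function of `z = x + i y`. -/
def IsHolomorphicQ (φ η : M → Space) : Prop :=
  ∀ e : OpenPartialHomeomorph M Plane, IsIsothermal φ η e →
    DifferentiableOn ℂ (hopfQ φ η e) {z : ℂ | (!₂[z.re, z.im] : Plane) ∈ e.target}

end Surface

/-- The cone
`X(u, v) = ((1/k) (1 - α v) cos (k u), (1/k) (1 - α v) sin (k u), β v)`. -/
def cone (α β k u v : ℝ) : Space :=
  !₂[1 / k * (1 - α * v) * Real.cos (k * u), 1 / k * (1 - α * v) * Real.sin (k * u), β * v]

end FlatSurface

end

/-! Near each point a flat surface carries positively oriented Cartesian coordinates `z = x + i y`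
with `g = dx² + dy²`. For an adapted frame `(E₁, E₂, N)` the exterior derivative of the connection
form `⟨E₂, dE₁⟩` is governed by `det A`, so flatness makes it closed; rotating the frame by a
potential makes it parallel, and integrating the dual coframe gives `x` and `y`
(`exists_parallel_frame`, `exists_flat_coordinates`).

Let `a, b, c` be the entries of the second fundamental form in these coordinates. Since `ac = b²`
and `a + c = 2f`, the holomorphic function `2Q = f ((a - c)/2 - i b)` has modulus `f² > 0`. Let `k =
t + i s` be a local holomorphic square root of `1/(2Q)`. Then `|k| = 1/f`, and the form is `2 f³ (t,
s) ⊗ (t, s)` (`rankOne_eq_of_inv_sqrt`). The Codazzi equations now force `Re k' = 0`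
(`re_eq_zero_of_codazzi`). As `k'` is holomorphic, it is a constant `i c` with `c` now a real
number, nonzero because `f` is not locally constant. So `k = i c (z - z₀)`, `f = 1/(|c| |z - z₀|)`,
and the second fundamental form is that of a developed circular cone with vertex `z₀`
(`IsFlatPatch.exists_hasConeForm`).

In polar coordinates about `z₀` the Gauss and Weingarten formulas become a linear system with
constant coefficients in the angle alone. Its first integrals are the vertex, the axis and two
horizontal directions, which displays the surface as the cone (`IsFlatPatch.exists_cone`). -/

namespace FlatSurface

/-! ### Inverse function theorem and change of charts -/

section LocalDiffeo

/-- The inverse function theorem on the plane: near a point of an open set, a smooth map with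
injective differentials restricts to a smooth diffeomorphism between open sets. -/
theorem exists_localDiffeo {Φ : Plane → Plane} {U : Set Plane} (hU : IsOpen U)
    (hΦ : ContDiffOn ℝ ∞ Φ U) (hinj : ∀ a ∈ U, Function.Injective (fderiv ℝ Φ a))
    {a₀ : Plane} (ha₀ : a₀ ∈ U) :
    ∃ g : OpenPartialHomeomorph Plane Plane, a₀ ∈ g.source ∧ g.source ⊆ U ∧ (∀ a, g a = Φ a) ∧
      ContDiffOn ℝ ∞ g g.source ∧ ContDiffOn ℝ ∞ g.symm g.target := by
  have hinv : ∀ a ∈ U, ∃ f' : Plane ≃L[ℝ] Plane, HasFDerivAt Φ (f' : Plane →L[ℝ] Plane) a := by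
    intro a ha
    have hd : DifferentiableAt ℝ Φ a :=
      (hΦ.contDiffAt (hU.mem_nhds ha)).differentiableAt (by simp)
    refine ⟨(LinearEquiv.ofInjectiveEndo (fderiv ℝ Φ a).toLinearMap
      (hinj a ha)).toContinuousLinearEquiv, ?_⟩
    convert hd.hasFDerivAt using 1
    ext1 v
    rfl
  obtain ⟨f', hf'⟩ := hinv a₀ ha₀
  have hc := hΦ.contDiffAt (hU.mem_nhds ha₀)
  set g₀ := hc.toOpenPartialHomeomorph Φ hf' (by simp) with hg₀
  have hg₀c : ∀ a, g₀ a = Φ a := fun a => rfl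
  have hsub : (g₀.restrOpen U hU).source ⊆ U := by
    rw [OpenPartialHomeomorph.restrOpen_source]; exact Set.inter_subset_right
  have hsm : ContDiffOn ℝ ∞ (g₀.restrOpen U hU) (g₀.restrOpen U hU).source := hΦ.mono hsub
  refine ⟨g₀.restrOpen U hU, ?_, hsub, fun a => rfl, hsm, ?_⟩
  · rw [OpenPartialHomeomorph.restrOpen_source]
    exact ⟨hc.mem_toOpenPartialHomeomorph_source hf' (by simp), ha₀⟩
  -- Smoothness of the inverse is needed on the whole target, not only at the base point; this is
  -- why invertibility of the differential is available throughout `U`.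
  · intro b hb
    have hbs := (g₀.restrOpen U hU).map_target hb
    obtain ⟨f'', hf''⟩ := hinv _ (hsub hbs)
    exact ((g₀.restrOpen U hU).contDiffAt_symm hb hf''
      (hΦ.contDiffAt (hU.mem_nhds (hsub hbs)))).contDiffWithinAt

variable {M : Type*} [TopologicalSpace M] [ChartedSpace Plane M] [IsManifold (𝓡 2) ∞ M]

theorem trans_mem_maximalAtlas {e : OpenPartialHomeomorph M Plane}
    (he : e ∈ IsManifold.maximalAtlas (𝓡 2) ∞ M) {g : OpenPartialHomeomorph Plane Plane}
    (hg : ContDiffOn ℝ ∞ g g.source) (hg' : ContDiffOn ℝ ∞ g.symm g.target) :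
    e.trans g ∈ IsManifold.maximalAtlas (𝓡 2) ∞ M := by
  have h1 := contMDiffOn_of_mem_maximalAtlas he
  have h2 := contMDiffOn_symm_of_mem_maximalAtlas he
  refine OpenPartialHomeomorph.mem_maximalAtlas_of_contMDiffOn _ ?_ ?_
  · rw [OpenPartialHomeomorph.trans_source]
    exact (contMDiffOn_iff_contDiffOn.2 hg).comp (h1.mono Set.inter_subset_left)
      (fun x hx => hx.2)
  · rw [OpenPartialHomeomorph.trans_target]
    exact h2.comp ((contMDiffOn_iff_contDiffOn.2 hg').mono Set.inter_subset_left)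
      (fun x hx => hx.2)

end LocalDiffeo

/-! ### Poincaré lemma for forms `⟨B, dA⟩` -/

section Potential

variable {E F : Type*} [NormedAddCommGroup E] [NormedSpace ℝ E]
  [NormedAddCommGroup F] [InnerProductSpace ℝ F]

/-- Poincaré's lemma for the one-form `⟨B, dA⟩`. -/
theorem exists_potential_inner_fderiv {A B : E → F} {U : Set E} (hU : IsOpen U)
    (hconv : Convex ℝ U) (hA : ContDiffOn ℝ ∞ A U) (hB : ContDiffOn ℝ ∞ B U)
    (hsymm : ∀ a ∈ U, ∀ v w, inner ℝ (fderiv ℝ B a v) (fderiv ℝ A a w) =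
      inner ℝ (fderiv ℝ B a w) (fderiv ℝ A a v)) :
    ∃ ψ : E → ℝ, ContDiffOn ℝ ∞ ψ U ∧
      ∀ a ∈ U, HasFDerivAt ψ ((innerSL ℝ (B a)).comp (fderiv ℝ A a)) a := by
  have hdA : ContDiffOn ℝ ∞ (fderiv ℝ A) U := ((contDiffOn_infty_iff_fderiv_of_isOpen hU).1 hA).2
  have hωs : ContDiffOn ℝ ∞ (fun a => (innerSL ℝ (B a)).comp (fderiv ℝ A a)) U :=
    ((innerSL ℝ (E := F)).contDiff.comp_contDiffOn hB).clm_comp hdA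
  obtain ⟨ψ, hψ⟩ := hconv.exists_forall_hasFDerivAt_of_fderiv_symmetric hU
    (hωs.differentiableOn (by simp)) (by
      intro a ha x y
      have hAa := hA.contDiffAt (hU.mem_nhds ha)
      have h1 : HasFDerivAt (fderiv ℝ A) (fderiv ℝ (fderiv ℝ A) a) a :=
        ((hdA.contDiffAt (hU.mem_nhds ha)).differentiableAt (by simp)).hasFDerivAt
      have h2 : HasFDerivAt (fun b => innerSL ℝ (B b))
          ((innerSL ℝ (E := F)).comp (fderiv ℝ B a)) a :=
        (innerSL ℝ (E := F)).hasFDerivAt.comp a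
          (((hB.contDiffAt (hU.mem_nhds ha)).differentiableAt (by simp)).hasFDerivAt)
      have h3 := (h2.clm_comp h1).fderiv
      -- In `d⟨B, dA⟩` the second derivative of `A` cancels by symmetry, so closedness reduces to
      -- the symmetry hypothesis on `⟨dB, dA⟩`.
      have hs : fderiv ℝ (fderiv ℝ A) a x y = fderiv ℝ (fderiv ℝ A) a y x :=
        hAa.isSymmSndFDerivAt (by simp; exact WithTop.coe_le_coe.2 le_top) x y
      rw [h3]
      simp [hs, hsymm a ha x y])
  refine ⟨ψ, ?_, hψ⟩
  rw [contDiffOn_infty_iff_fderiv_of_isOpen hU]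
  exact ⟨fun a ha => (hψ a ha).differentiableAt.differentiableWithinAt,
    hωs.congr fun a ha => (hψ a ha).fderiv⟩

end Potential

/-! ### Orthonormal triples and the cross product in `ℝ³` -/

section Orthonormal

theorem orthonormal_triple {a b c : Space} (ha : inner ℝ a a = (1 : ℝ))
    (hb : inner ℝ b b = (1 : ℝ)) (hc : inner ℝ c c = (1 : ℝ)) (hab : inner ℝ a b = (0 : ℝ))
    (hac : inner ℝ a c = (0 : ℝ)) (hbc : inner ℝ b c = (0 : ℝ)) :
    Orthonormal ℝ ![a, b, c] := by
  rw [orthonormal_iff_ite]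
  have hba := hab; have hca := hac; have hcb := hbc
  rw [real_inner_comm] at hba hca hcb
  intro i j
  have hna : ‖a‖ = 1 := by rw [norm_eq_sqrt_real_inner, ha, Real.sqrt_one]
  have hnb : ‖b‖ = 1 := by rw [norm_eq_sqrt_real_inner, hb, Real.sqrt_one]
  have hnc : ‖c‖ = 1 := by rw [norm_eq_sqrt_real_inner, hc, Real.sqrt_one]
  fin_cases i <;> fin_cases j <;> simp [hna, hnb, hnc, hab, hac, hbc, hba, hca, hcb]

/-- The orthonormal basis of `ℝ³` formed by an orthonormal triple. -/
theorem exists_orthonormalBasis {a b c : Space} (h : Orthonormal ℝ ![a, b, c]) :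
    ∃ o : OrthonormalBasis (Fin 3) ℝ Space, o 0 = a ∧ o 1 = b ∧ o 2 = c := by
  have hcard : Fintype.card (Fin 3) = Module.finrank ℝ Space := by simp
  refine ⟨(basisOfOrthonormalOfCardEqFinrank h hcard).toOrthonormalBasis (by simpa using h),
    ?_, ?_, ?_⟩ <;> simp

theorem inner_eq_of_orthonormal {a b c : Space} (h : Orthonormal ℝ ![a, b, c]) (x y : Space) :
    (inner ℝ x y : ℝ) = inner ℝ x a * inner ℝ a y + inner ℝ x b * inner ℝ b y +
      inner ℝ x c * inner ℝ c y := by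
  obtain ⟨o, rfl, rfl, rfl⟩ := exists_orthonormalBasis h
  rw [← o.sum_inner_mul_inner x y, Fin.sum_univ_three]

theorem eq_of_orthonormal {a b c : Space} (h : Orthonormal ℝ ![a, b, c]) (x : Space) :
    x = (inner ℝ a x : ℝ) • a + (inner ℝ b x : ℝ) • b + (inner ℝ c x : ℝ) • c := by
  obtain ⟨o, rfl, rfl, rfl⟩ := exists_orthonormalBasis h
  conv_lhs => rw [← o.sum_repr' x, Fin.sum_univ_three]

/-- The cross product in `ℝ³`. -/
def cross (a b : Space) : Space :=
  !₂[a 1 * b 2 - a 2 * b 1, a 2 * b 0 - a 0 * b 2, a 0 * b 1 - a 1 * b 0]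

theorem inner_space (a b : Space) : (inner ℝ a b : ℝ) = a 0 * b 0 + a 1 * b 1 + a 2 * b 2 := by
  rw [PiLp.inner_apply, Fin.sum_univ_three]
  simp [mul_comm]

theorem inner_cross_left (a b : Space) : (inner ℝ a (cross a b) : ℝ) = 0 := by
  rw [inner_space]; simp [cross]; ring

theorem inner_cross_right (a b : Space) : (inner ℝ b (cross a b) : ℝ) = 0 := by
  rw [inner_space]; simp [cross]; ring

theorem inner_cross_self (a b : Space) : (inner ℝ (cross a b) (cross a b) : ℝ) =
    inner ℝ a a * inner ℝ b b - inner ℝ a b ^ 2 := by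
  simp only [inner_space]; simp [cross]; ring

theorem contDiffOn_cross {E : Type*} [NormedAddCommGroup E] [NormedSpace ℝ E] {A B : E → Space}
    {U : Set E} (hA : ContDiffOn ℝ ∞ A U) (hB : ContDiffOn ℝ ∞ B U) :
    ContDiffOn ℝ ∞ (fun a => cross (A a) (B a)) U := by
  rw [contDiffOn_euclidean] at hA hB ⊢
  intro i
  fin_cases i <;> simp [cross]
  · exact ((hA 1).mul (hB 2)).sub ((hA 2).mul (hB 1))
  · exact ((hA 2).mul (hB 0)).sub ((hA 0).mul (hB 2))
  · exact ((hA 0).mul (hB 1)).sub ((hA 1).mul (hB 0))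

/-- The determinant of a triple of vectors of `ℝ³`. -/
theorem det_eq_inner_cross (a b c : Space) :
    (Matrix.of ![a.ofLp, b.ofLp, c.ofLp]).det = inner ℝ a (cross b c) := by
  rw [inner_space, Matrix.det_fin_three]; simp [cross]; ring

end Orthonormal

end FlatSurface

namespace FlatSurface

/-! ### Geometric quantities expressed in a chart -/

section LocalRepresentative

/-- The standard basis of the coordinate plane. -/
noncomputable def planeVec (i : Fin 2) : Plane := EuclideanSpace.single i (1 : ℝ)

theorem plane_eq_sum (v : Plane) : v = v 0 • planeVec 0 + v 1 • planeVec 1 := by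
  ext i; fin_cases i <;> simp [planeVec]

/-- The coefficients `⟨A ∂_i, ∂_j⟩` of the shape operator of a parametrized surface `Y` with unit
normal `N`. -/
noncomputable def shapeCoeff (Y N : Plane → Space) (a : Plane) (i j : Fin 2) : ℝ :=
  - inner ℝ (fderiv ℝ N a (planeVec i)) (fderiv ℝ Y a (planeVec j))

variable {M : Type*} [TopologicalSpace M] [ChartedSpace Plane M]
  {e : OpenPartialHomeomorph M Plane}

theorem mdifferentiable_of_mem_maximalAtlas (he : e ∈ IsManifold.maximalAtlas (𝓡 2) ∞ M) :
    e.MDifferentiable (𝓡 2) (𝓡 2) :=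
  ⟨(contMDiffOn_of_mem_maximalAtlas he).mdifferentiableOn (by simp),
    (contMDiffOn_symm_of_mem_maximalAtlas he).mdifferentiableOn (by simp)⟩

theorem contDiffOn_comp_symm (he : e ∈ IsManifold.maximalAtlas (𝓡 2) ∞ M) {F : M → Space}
    (hF : ContMDiff (𝓡 2) 𝓘(ℝ, Space) ∞ F) : ContDiffOn ℝ ∞ (F ∘ e.symm) e.target :=
  contMDiffOn_iff_contDiffOn.1 (hF.comp_contMDiffOn (contMDiffOn_symm_of_mem_maximalAtlas he))

theorem fderiv_comp_symm (he : e ∈ IsManifold.maximalAtlas (𝓡 2) ∞ M) {F : M → Space}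
    (hF : ContMDiff (𝓡 2) 𝓘(ℝ, Space) ∞ F) {a : Plane} (ha : a ∈ e.target) (w : Plane) :
    fderiv ℝ (F ∘ e.symm) a w = diff F (e.symm a) (mfderiv (𝓡 2) (𝓡 2) e.symm a w) := by
  rw [← mfderiv_eq_fderiv]
  exact mfderiv_comp_apply a ((hF _).mdifferentiableAt (by simp))
    ((mdifferentiable_of_mem_maximalAtlas he).mdifferentiableAt_symm ha) w

theorem fderiv_comp_symm_planeVec (he : e ∈ IsManifold.maximalAtlas (𝓡 2) ∞ M) {F : M → Space}
    (hF : ContMDiff (𝓡 2) 𝓘(ℝ, Space) ∞ F) {a : Plane} (ha : a ∈ e.target) (i : Fin 2) :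
    fderiv ℝ (F ∘ e.symm) a (planeVec i) = diff F (e.symm a) (coordVec e a i) :=
  fderiv_comp_symm he hF ha _

theorem mfderiv_symm_injective (he : e ∈ IsManifold.maximalAtlas (𝓡 2) ∞ M) {a : Plane}
    (ha : a ∈ e.target) : Function.Injective (mfderiv (𝓡 2) (𝓡 2) e.symm a) :=
  (mdifferentiable_of_mem_maximalAtlas he).symm.mfderiv_injective ha

/-- The matrix of the coordinate vectors of `e` in the standard basis. -/
noncomputable def coordMatrix (e : OpenPartialHomeomorph M Plane) (a : Plane) :
    Matrix (Fin 2) (Fin 2) ℝ :=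
  Matrix.of fun k i => (show Plane from coordVec e a i) k

theorem coordVec_eq_sum (a : Plane) (i : Fin 2) : coordVec e a i =
    coordMatrix e a 0 i • stdVec (e.symm a) 0 + coordMatrix e a 1 i • stdVec (e.symm a) 1 :=
  plane_eq_sum (show Plane from coordVec e a i)

theorem det_coordMatrix_ne_zero (he : e ∈ IsManifold.maximalAtlas (𝓡 2) ∞ M) {a : Plane}
    (ha : a ∈ e.target) : (coordMatrix e a).det ≠ 0 := by
  intro h0
  obtain ⟨v, hv, hv0⟩ := Matrix.exists_mulVec_eq_zero_iff.2 h0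
  have hz : mfderiv (𝓡 2) (𝓡 2) e.symm a (v 0 • planeVec 0 + v 1 • planeVec 1 : Plane) = 0 := by
    have h : mfderiv (𝓡 2) (𝓡 2) e.symm a (v 0 • planeVec 0 + v 1 • planeVec 1 : Plane) =
        v 0 • coordVec e a 0 + v 1 • coordVec e a 1 := by
      have h' : ∀ L : Plane →L[ℝ] Plane, L (v 0 • planeVec 0 + v 1 • planeVec 1) =
          v 0 • L (planeVec 0) + v 1 • L (planeVec 1) := fun L => by simp
      exact h' (mfderiv (𝓡 2) (𝓡 2) e.symm a)
    rw [h]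
    rw [coordVec_eq_sum, coordVec_eq_sum]
    have h1 := congrFun hv0 0
    have h2 := congrFun hv0 1
    simp [Matrix.mulVec, dotProduct, Fin.sum_univ_two] at h1 h2
    have : ∀ x y : TangentSpace (𝓡 2) (e.symm a), v 0 • (coordMatrix e a 0 0 • x +
        coordMatrix e a 1 0 • y) + v 1 • (coordMatrix e a 0 1 • x + coordMatrix e a 1 1 • y) =
        (coordMatrix e a 0 0 * v 0 + coordMatrix e a 0 1 * v 1) • x +
        (coordMatrix e a 1 0 * v 0 + coordMatrix e a 1 1 * v 1) • y := by
      intro x y; module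
    rw [this, h1, h2]; simp
  have h3 := mfderiv_symm_injective he ha (hz.trans (map_zero _).symm)
  apply hv
  ext i
  have h4 : (v 0 • planeVec 0 + v 1 • planeVec 1 : Plane) i = (0 : Plane) i :=
    congrArg (fun w : Plane => w i) h3
  fin_cases i <;> simpa [planeVec] using h4

variable {φ η : M → Space}

/-- A kernel vector `v` of the Gram matrix satisfies `|dφ v|² = 0`, which injectivity of `dφ`
excludes. -/
theorem det_metricMatrix_ne_zero (hφ : IsSmoothImmersion φ) (p : M) :
    (metricMatrix φ p).det ≠ 0 := by
  intro h0
  obtain ⟨v, hv, hv0⟩ := Matrix.exists_mulVec_eq_zero_iff.2 h0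
  have h1 := congrFun hv0 0
  have h2 := congrFun hv0 1
  simp [Matrix.mulVec, dotProduct, Fin.sum_univ_two, metricMatrix, metric] at h1 h2
  have hz : inner ℝ (diff φ p (v 0 • stdVec p 0 + v 1 • stdVec p 1))
      (diff φ p (v 0 • stdVec p 0 + v 1 • stdVec p 1)) = (0 : ℝ) := by
    simp only [map_add, map_smul, inner_add_left, inner_add_right, real_inner_smul_left,
      real_inner_smul_right, real_inner_self_eq_norm_sq, norm_smul, mul_pow,
      Real.norm_eq_abs, sq_abs]
    linear_combination v 0 * h1 + v 1 * h2
  have h3 := hφ.injective_diff p ((inner_self_eq_zero.1 hz).trans (map_zero _).symm)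
  apply hv
  ext i
  have := congrArg (fun w : TangentSpace (𝓡 2) p => (show Plane from w) i) h3
  have h4 : (v 0 • planeVec 0 + v 1 • planeVec 1) i = 0 := this
  fin_cases i <;> simpa [planeVec] using h4

/-- Bilinear forms change by congruence; this and its analogue for the shape form carry curvature
from the standard basis of `T_p M` to any chart. -/
theorem metric_coordVec (a : Plane) :
    (Matrix.of fun i j => metric φ (e.symm a) (coordVec e a i) (coordVec e a j)) =
      (coordMatrix e a).transpose * metricMatrix φ (e.symm a) * coordMatrix e a := by
  ext i j
  simp only [Matrix.mul_apply, Fin.sum_univ_two, Matrix.of_apply, metric, metricMatrix,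
    Matrix.transpose_apply]
  rw [coordVec_eq_sum, coordVec_eq_sum]
  simp only [map_add, map_smul, inner_add_left, inner_add_right, real_inner_smul_left,
      real_inner_smul_right]
  ring

theorem shapeForm_coordVec (a : Plane) :
    (Matrix.of fun i j => shapeForm φ η (e.symm a) (coordVec e a j) (coordVec e a i)) =
      (coordMatrix e a).transpose * (Matrix.of fun i j =>
        shapeForm φ η (e.symm a) (stdVec (e.symm a) j) (stdVec (e.symm a) i)) *
        coordMatrix e a := by
  ext i j
  simp only [Matrix.mul_apply, Fin.sum_univ_two, Matrix.of_apply, shapeForm,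
    Matrix.transpose_apply]
  rw [coordVec_eq_sum, coordVec_eq_sum]
  simp only [map_add, map_smul, inner_add_left, inner_add_right, real_inner_smul_left,
      real_inner_smul_right]
  ring

theorem shapeForm_coordVec_eq (he : e ∈ IsManifold.maximalAtlas (𝓡 2) ∞ M)
    (hφ : ContMDiff (𝓡 2) 𝓘(ℝ, Space) ∞ φ) (hη : ContMDiff (𝓡 2) 𝓘(ℝ, Space) ∞ η) {a : Plane}
    (ha : a ∈ e.target) (i j : Fin 2) :
    shapeForm φ η (e.symm a) (coordVec e a i) (coordVec e a j) =
      shapeCoeff (φ ∘ e.symm) (η ∘ e.symm) a i j := by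
  rw [shapeCoeff, fderiv_comp_symm_planeVec he hφ ha, fderiv_comp_symm_planeVec he hη ha]
  rfl

/-- In any chart, flatness means that the second fundamental form is degenerate. -/
theorem det_shapeCoeff_eq_zero (he : e ∈ IsManifold.maximalAtlas (𝓡 2) ∞ M)
    (hφ : IsSmoothImmersion φ) (hη : IsUnitNormal φ η) {a : Plane}
    (ha : a ∈ e.target) (hflat : gaussCurvature φ η (e.symm a) = 0) :
    shapeCoeff (φ ∘ e.symm) (η ∘ e.symm) a 0 0 * shapeCoeff (φ ∘ e.symm) (η ∘ e.symm) a 1 1 =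
    shapeCoeff (φ ∘ e.symm) (η ∘ e.symm) a 0 1 * shapeCoeff (φ ∘ e.symm) (η ∘ e.symm) a 1 0 := by
  have hG := det_metricMatrix_ne_zero hφ (e.symm a)
  rw [gaussCurvature, shapeMatrix, Matrix.det_mul, Matrix.det_nonsing_inv] at hflat
  have hS := (mul_eq_zero.1 hflat).resolve_left (by simpa using hG)
  have h := congrArg Matrix.det (shapeForm_coordVec (e := e) (φ := φ) (η := η) a)
  rw [Matrix.det_mul, Matrix.det_mul, hS, Matrix.det_fin_two] at h
  simp only [Matrix.of_apply, shapeForm_coordVec_eq he hφ.smooth hη.smooth ha] at h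
  linear_combination h

/-- In a chart whose coordinate vectors are orthonormal, the mean curvature is half the trace of
the second fundamental form. -/
theorem meanCurvature_eq (he : e ∈ IsManifold.maximalAtlas (𝓡 2) ∞ M)
    (hφ : IsSmoothImmersion φ) (hη : IsUnitNormal φ η) {a : Plane} (ha : a ∈ e.target)
    (horth : ∀ i j, metric φ (e.symm a) (coordVec e a i) (coordVec e a j) =
      if i = j then 1 else 0) :
    meanCurvature φ η (e.symm a) = (shapeCoeff (φ ∘ e.symm) (η ∘ e.symm) a 0 0 +
      shapeCoeff (φ ∘ e.symm) (η ∘ e.symm) a 1 1) / 2 := by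
  have hC := det_coordMatrix_ne_zero he ha
  have hG := det_metricMatrix_ne_zero hφ (e.symm a)
  have h1 : (coordMatrix e a).transpose * metricMatrix φ (e.symm a) * coordMatrix e a = 1 := by
    rw [← metric_coordVec]
    ext i j
    simp [horth, Matrix.one_apply]
  have h2 : (metricMatrix φ (e.symm a))⁻¹ = coordMatrix e a * (coordMatrix e a).transpose := by
    refine Matrix.inv_eq_left_inv ?_
    rw [mul_assoc]
    exact mul_eq_one_comm.1 h1
  have h3 := congrArg Matrix.trace (shapeForm_coordVec (e := e) (φ := φ) (η := η) a)
  -- With orthonormal coordinate vectors `G⁻¹ = C Cᵀ`, so cyclicity of the trace turns `tr (G⁻¹ S)`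
  -- into `tr (Cᵀ S C)`.
  rw [mul_assoc, Matrix.trace_mul_comm, mul_assoc, Matrix.trace_mul_comm,
    Matrix.trace_fin_two] at h3
  simp only [Matrix.of_apply, shapeForm_coordVec_eq he hφ.smooth hη.smooth ha] at h3
  rw [meanCurvature, shapeMatrix, h2, h3, Matrix.trace_mul_comm]

/-- Because `|η| = 1`, pairing `B` with `H` multiplies the shape form by `f`; what remains is the
expansion at `∂_z`. -/
theorem hopfQ_eq (he : e ∈ IsManifold.maximalAtlas (𝓡 2) ∞ M)
    (hφ : IsSmoothImmersion φ) (hη : IsUnitNormal φ η) {z : ℂ}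
    (hz : (!₂[z.re, z.im] : Plane) ∈ e.target) :
    hopfQ φ η e z = meanCurvature φ η (e.symm !₂[z.re, z.im]) *
      (shapeCoeff (φ ∘ e.symm) (η ∘ e.symm) !₂[z.re, z.im] 0 0 -
      shapeCoeff (φ ∘ e.symm) (η ∘ e.symm) !₂[z.re, z.im] 1 1 - Complex.I *
      (shapeCoeff (φ ∘ e.symm) (η ∘ e.symm) !₂[z.re, z.im] 0 1 +
      shapeCoeff (φ ∘ e.symm) (η ∘ e.symm) !₂[z.re, z.im] 1 0)) / 4 := by
  have hN : inner ℝ (η (e.symm !₂[z.re, z.im])) (η (e.symm !₂[z.re, z.im])) = (1 : ℝ) := by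
    rw [real_inner_self_eq_norm_sq, hη.norm_eq_one]; norm_num
  simp only [hopfQ, secondForm, meanCurvatureVector, real_inner_smul_left, real_inner_smul_right,
    hN, shapeForm_coordVec_eq he hφ.smooth hη.smooth hz]
  push_cast
  linear_combination (1 / 4 : ℂ) * (meanCurvature φ η (e.symm !₂[z.re, z.im])) *
    (shapeCoeff (φ ∘ e.symm) (η ∘ e.symm) !₂[z.re, z.im] 1 1) * Complex.I_sq

/-- The gradient vanishes where the differential does. -/
theorem gradNorm_eq_zero {f : M → ℝ} {p : M} (h : mfderiv (𝓡 2) 𝓘(ℝ, ℝ) f p = 0) :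
    gradNorm φ f p = 0 := by
  have : grad φ f p = 0 := by
    simp only [grad, h]
    refine Finset.sum_eq_zero fun i _ => ?_
    have : (fun j : Fin 2 => ((0 : TangentSpace (𝓡 2) p →L[ℝ] TangentSpace 𝓘(ℝ, ℝ) (f p))
      (stdVec p j) : ℝ)) = (0 : Fin 2 → ℝ) := by ext j; rfl
    refine (congrArg (fun w : Fin 2 → ℝ => (metricMatrix φ p)⁻¹.mulVec w i • stdVec p i)
      this).trans ?_
    simp
  simp [gradNorm, this, metric]

end LocalRepresentative

end FlatSurface

namespace FlatSurface

/-! ### Parallel frames and Cartesian coordinates -/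

section FlatCoordinates

theorem inner_of_orthonormal {a b c : Space} (h : Orthonormal ℝ ![a, b, c]) :
    inner ℝ a a = (1 : ℝ) ∧ inner ℝ b b = (1 : ℝ) ∧ inner ℝ a b = (0 : ℝ) ∧
      inner ℝ a c = (0 : ℝ) ∧ inner ℝ b c = (0 : ℝ) := by
  have h' := orthonormal_iff_ite.1 h
  exact ⟨h' 0 0, h' 1 1, h' 0 1, h' 0 2, h' 1 2⟩

/-- Differentiated orthonormality relations: the source of all the structure equations used below.
-/
theorem inner_fderiv_add_eq_zero {E F : Type*} [NormedAddCommGroup E] [NormedSpace ℝ E]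
    [NormedAddCommGroup F] [InnerProductSpace ℝ F] {A B : E → F} {U : Set E} (hU : IsOpen U)
    (hA : ContDiffOn ℝ ∞ A U) (hB : ContDiffOn ℝ ∞ B U) {c : ℝ}
    (h : ∀ a ∈ U, inner ℝ (A a) (B a) = c) {a : E} (ha : a ∈ U) (v : E) :
    inner ℝ (A a) (fderiv ℝ B a v) + inner ℝ (fderiv ℝ A a v) (B a) = (0 : ℝ) := by
  have hAa := (hA.contDiffAt (hU.mem_nhds ha)).differentiableAt (by simp)
  have hBa := (hB.contDiffAt (hU.mem_nhds ha)).differentiableAt (by simp)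
  rw [← fderiv_inner_apply ℝ hAa hBa]
  have : (fun t => (inner ℝ (A t) (B t) : ℝ)) =ᶠ[nhds a] fun _ => c :=
    Filter.eventually_of_mem (hU.mem_nhds ha) h
  rw [this.fderiv_eq]; simp

variable {X N : Plane → Space} {U : Set Plane}

/-- A positively oriented smooth orthonormal frame adapted to a parametrized surface. -/
theorem exists_adapted_frame (hU : IsOpen U) (hX : ContDiffOn ℝ ∞ X U) (hN : ContDiffOn ℝ ∞ N U)
    (hinj : ∀ a ∈ U, Function.Injective (fderiv ℝ X a))
    (hNN : ∀ a ∈ U, inner ℝ (N a) (N a) = (1 : ℝ))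
    (hXN : ∀ a ∈ U, ∀ v, inner ℝ (fderiv ℝ X a v) (N a) = (0 : ℝ)) :
    ∃ E₁ E₂ : Plane → Space, ContDiffOn ℝ ∞ E₁ U ∧ ContDiffOn ℝ ∞ E₂ U ∧
      ∀ a ∈ U, Orthonormal ℝ ![E₁ a, E₂ a, N a] ∧ 0 < (inner ℝ (E₁ a) (cross (E₂ a) (N a)) : ℝ) := by
  have hV : ContDiffOn ℝ ∞ (fun a => fderiv ℝ X a (planeVec 0)) U :=
    ((contDiffOn_infty_iff_fderiv_of_isOpen hU).1 hX).2.clm_apply contDiffOn_const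
  have hV0 : ∀ a ∈ U, fderiv ℝ X a (planeVec 0) ≠ 0 := by
    intro a ha h0
    have h := congrArg (fun w : Plane => w 0) (hinj a ha (h0.trans (map_zero _).symm))
    simp [planeVec] at h
  have hE : ContDiffOn ℝ ∞ (fun a => (‖fderiv ℝ X a (planeVec 0)‖)⁻¹ •
      fderiv ℝ X a (planeVec 0)) U :=
    ((hV.norm ℝ hV0).inv fun a ha => norm_ne_zero_iff.2 (hV0 a ha)).smul hV
  -- The second vector is `N × E₁`, which fixes the orientation.
  refine ⟨_, _, hE, contDiffOn_cross hN hE, fun a ha => ?_⟩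
  set E := (‖fderiv ℝ X a (planeVec 0)‖)⁻¹ • fderiv ℝ X a (planeVec 0) with hEdef
  have hEE : inner ℝ E E = (1 : ℝ) := by
    rw [real_inner_self_eq_norm_sq, hEdef, norm_smul, norm_inv, norm_norm,
      inv_mul_cancel₀ (norm_ne_zero_iff.2 (hV0 a ha)), one_pow]
  have hEN : inner ℝ E (N a) = (0 : ℝ) := by
    rw [hEdef, real_inner_smul_left, hXN a ha, mul_zero]
  have hNE : inner ℝ (N a) E = (0 : ℝ) := by rw [real_inner_comm]; exact hEN
  refine ⟨orthonormal_triple hEE ?_ (hNN a ha) (inner_cross_right _ _) hEN ?_, ?_⟩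
  · rw [inner_cross_self, hNN a ha, hEE, hNE]; norm_num
  · rw [real_inner_comm]; exact inner_cross_left _ _
  · have : (inner ℝ E (cross (cross (N a) E) (N a)) : ℝ) =
        inner ℝ E E * inner ℝ (N a) (N a) - inner ℝ E (N a) ^ 2 := by
      simp only [inner_space]; simp [cross]; ring
    rw [this, hEE, hNN a ha, hEN]; norm_num

/-- In an adapted frame, degeneracy of the second fundamental form says that the components of
`dN` are proportional. -/
theorem inner_fderiv_normal_symm {a : Plane} {e₁ e₂ n : Space} (h : Orthonormal ℝ ![e₁, e₂, n])
    (hinj : Function.Injective (fderiv ℝ X a))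
    (hXN : ∀ v, inner ℝ (fderiv ℝ X a v) n = (0 : ℝ))
    (hdet : shapeCoeff X N a 0 0 * shapeCoeff X N a 1 1 =
      shapeCoeff X N a 0 1 * shapeCoeff X N a 1 0) (v w : Plane) :
    (inner ℝ (fderiv ℝ N a v) e₁ * inner ℝ (fderiv ℝ N a w) e₂ : ℝ) =
      inner ℝ (fderiv ℝ N a w) e₁ * inner ℝ (fderiv ℝ N a v) e₂ := by
  have hXN' : ∀ v, inner ℝ n (fderiv ℝ X a v) = (0 : ℝ) := fun v => by
    rw [real_inner_comm]; exact hXN v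
  have hexp : ∀ v w, (inner ℝ (fderiv ℝ N a v) (fderiv ℝ X a w) : ℝ) =
      inner ℝ (fderiv ℝ N a v) e₁ * inner ℝ e₁ (fderiv ℝ X a w) +
      inner ℝ (fderiv ℝ N a v) e₂ * inner ℝ e₂ (fderiv ℝ X a w) := fun v w => by
    rw [inner_eq_of_orthonormal h, hXN', mul_zero, add_zero]
  simp only [shapeCoeff, hexp] at hdet
  set x₀ : ℝ := inner ℝ e₁ (fderiv ℝ X a (planeVec 0)) with hx₀
  set x₁ : ℝ := inner ℝ e₁ (fderiv ℝ X a (planeVec 1)) with hx₁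
  set y₀ : ℝ := inner ℝ e₂ (fderiv ℝ X a (planeVec 0)) with hy₀
  set y₁ : ℝ := inner ℝ e₂ (fderiv ℝ X a (planeVec 1)) with hy₁
  have hD : x₀ * y₁ - x₁ * y₀ ≠ 0 := by
    intro h0
    have key : ∀ s t : ℝ, s * x₀ + t * x₁ = 0 → s * y₀ + t * y₁ = 0 → s = 0 ∧ t = 0 := by
      intro s t h1 h2
      have h3 : fderiv ℝ X a (s • planeVec 0 + t • planeVec 1) = 0 := by
        rw [map_add, map_smul, map_smul, eq_of_orthonormal h (fderiv ℝ X a (planeVec 0)),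
          eq_of_orthonormal h (fderiv ℝ X a (planeVec 1)), hXN', hXN', ← hx₀, ← hx₁, ← hy₀, ← hy₁]
        have : s • (x₀ • e₁ + y₀ • e₂ + (0 : ℝ) • n) + t • (x₁ • e₁ + y₁ • e₂ + (0 : ℝ) • n) =
          (s * x₀ + t * x₁) • e₁ + (s * y₀ + t * y₁) • e₂ := by module
        rw [this, h1, h2]; simp
      have h4 := hinj (h3.trans (map_zero _).symm)
      have h5 := congrArg (fun w : Plane => w 0) h4
      have h6 := congrArg (fun w : Plane => w 1) h4
      exact ⟨by simpa [planeVec] using h5, by simpa [planeVec] using h6⟩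
    -- If the determinant vanished, its rows would give kernel vectors of `dX`; these must be zero,
    -- hence so are all entries, and then `(1, 0)` lies in the kernel.
    have h1 := key x₁ (-x₀) (by ring) (by linear_combination -h0)
    have h2 := key y₁ (-y₀) (by linear_combination h0) (by ring)
    have h3 := key 1 0 (by linarith [h1.2]) (by linarith [h2.2])
    exact one_ne_zero h3.1
  rw [plane_eq_sum v, plane_eq_sum w]
  simp only [map_add, map_smul, inner_add_left, real_inner_smul_left]
  -- The determinant of the second fundamental form factors as that of the components of `dN` times
  -- that of `dX`, and the latter is nonzero.
  refine mul_left_cancel₀ hD ?_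
  linear_combination (v 0 * w 1 - v 1 * w 0) * hdet

/-- A frame which is parallel, i.e. whose differentials are normal. -/
theorem exists_parallel_frame (hU : IsOpen U) (hconv : Convex ℝ U) (hX : ContDiffOn ℝ ∞ X U)
    (hN : ContDiffOn ℝ ∞ N U) (hinj : ∀ a ∈ U, Function.Injective (fderiv ℝ X a))
    (hNN : ∀ a ∈ U, inner ℝ (N a) (N a) = (1 : ℝ))
    (hXN : ∀ a ∈ U, ∀ v, inner ℝ (fderiv ℝ X a v) (N a) = (0 : ℝ))
    (hdet : ∀ a ∈ U, shapeCoeff X N a 0 0 * shapeCoeff X N a 1 1 =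
      shapeCoeff X N a 0 1 * shapeCoeff X N a 1 0) :
    ∃ F₁ F₂ : Plane → Space, ContDiffOn ℝ ∞ F₁ U ∧ ContDiffOn ℝ ∞ F₂ U ∧
      ∀ a ∈ U, Orthonormal ℝ ![F₁ a, F₂ a, N a] ∧
        0 < (inner ℝ (F₁ a) (cross (F₂ a) (N a)) : ℝ) ∧
        ∀ v, inner ℝ (fderiv ℝ F₁ a v) (F₂ a) = (0 : ℝ) := by
  obtain ⟨E₁, E₂, hE₁, hE₂, hE⟩ := exists_adapted_frame hU hX hN hinj hNN hXN
  have i11 : ∀ a ∈ U, inner ℝ (E₁ a) (E₁ a) = (1 : ℝ) := fun a ha =>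
    (inner_of_orthonormal (hE a ha).1).1
  have i22 : ∀ a ∈ U, inner ℝ (E₂ a) (E₂ a) = (1 : ℝ) := fun a ha =>
    (inner_of_orthonormal (hE a ha).1).2.1
  have i12 : ∀ a ∈ U, inner ℝ (E₁ a) (E₂ a) = (0 : ℝ) := fun a ha =>
    (inner_of_orthonormal (hE a ha).1).2.2.1
  have i1N : ∀ a ∈ U, inner ℝ (E₁ a) (N a) = (0 : ℝ) := fun a ha =>
    (inner_of_orthonormal (hE a ha).1).2.2.2.1
  have i2N : ∀ a ∈ U, inner ℝ (E₂ a) (N a) = (0 : ℝ) := fun a ha =>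
    (inner_of_orthonormal (hE a ha).1).2.2.2.2
  have d11 := fun a (ha : a ∈ U) => inner_fderiv_add_eq_zero hU hE₁ hE₁ i11 ha
  have d22 := fun a (ha : a ∈ U) => inner_fderiv_add_eq_zero hU hE₂ hE₂ i22 ha
  have d12 := fun a (ha : a ∈ U) => inner_fderiv_add_eq_zero hU hE₁ hE₂ i12 ha
  have d1N := fun a (ha : a ∈ U) => inner_fderiv_add_eq_zero hU hE₁ hN i1N ha
  have d2N := fun a (ha : a ∈ U) => inner_fderiv_add_eq_zero hU hE₂ hN i2N ha
  -- The connection form `⟨E₂, dE₁⟩` is closed: `dE₁` and `dE₂` have no common tangential direction,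
  -- so only their normal parts contribute, and these are the components of `dN`, proportional by
  -- flatness.
  obtain ⟨ψ, hψs, hψ⟩ := exists_potential_inner_fderiv hU hconv hE₁ hE₂ (by
    intro a ha v w
    have key := inner_fderiv_normal_symm (hE a ha).1 (hinj a ha) (hXN a ha) (hdet a ha) v w
    have h2 : ∀ v, (inner ℝ (fderiv ℝ E₂ a v) (E₂ a) : ℝ) = 0 := fun v => by
      have := d22 a ha v
      rw [real_inner_comm] at this; linarith
    have h1 : ∀ v, (inner ℝ (E₁ a) (fderiv ℝ E₁ a v) : ℝ) = 0 := fun v => by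
      have := d11 a ha v
      rw [real_inner_comm (E₁ a) (fderiv ℝ E₁ a v)] at this
      linarith
    have h1N : ∀ v, (inner ℝ (N a) (fderiv ℝ E₁ a v) : ℝ) = - inner ℝ (fderiv ℝ N a v) (E₁ a) :=
      fun v => by
        have := d1N a ha v
        rw [real_inner_comm, real_inner_comm (N a)] at this; linarith
    have h2N : ∀ v, (inner ℝ (fderiv ℝ E₂ a v) (N a) : ℝ) = - inner ℝ (fderiv ℝ N a v) (E₂ a) :=
      fun v => by
        have := d2N a ha v
        rw [real_inner_comm] at this; linarith
    rw [inner_eq_of_orthonormal (hE a ha).1, inner_eq_of_orthonormal (hE a ha).1 (fderiv ℝ E₂ a w)]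
    simp only [h2, h1, h1N, h2N]
    linear_combination -key)
  have hc := hψs.cos
  have hs := hψs.sin
  -- Rotation by `ψ` changes the connection form `⟨dE₁, E₂⟩` into `⟨dE₁, E₂⟩ - dψ = 0`.
  refine ⟨fun a => Real.cos (ψ a) • E₁ a - Real.sin (ψ a) • E₂ a,
    fun a => Real.sin (ψ a) • E₁ a + Real.cos (ψ a) • E₂ a,
    (hc.smul hE₁).sub (hs.smul hE₂), (hs.smul hE₁).add (hc.smul hE₂), fun a ha => ⟨?_, ?_, ?_⟩⟩
  · have hcs := Real.sin_sq_add_cos_sq (ψ a)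
    have j21 := i12 a ha
    rw [real_inner_comm] at j21
    apply orthonormal_triple <;>
      simp only [inner_add_left, inner_add_right, inner_sub_left, inner_sub_right,
        real_inner_smul_left, real_inner_smul_right, i11 a ha, i22 a ha, i12 a ha, i1N a ha,
        i2N a ha, j21, hNN a ha] <;>
      first
        | ring1
        | linear_combination -hcs
        | linear_combination hcs
  · have hcs := Real.sin_sq_add_cos_sq (ψ a)
    have : ∀ c s : ℝ, (inner ℝ (c • E₁ a - s • E₂ a) (cross (s • E₁ a + c • E₂ a) (N a)) : ℝ) =
        (s ^ 2 + c ^ 2) * inner ℝ (E₁ a) (cross (E₂ a) (N a)) := by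
      intro c s
      simp only [inner_space]; simp [cross]; ring
    rw [this, hcs, one_mul]
    exact (hE a ha).2
  · intro v
    have hD₁ := ((hE₁.contDiffAt (hU.mem_nhds ha)).differentiableAt (by simp)).hasFDerivAt
    have hD₂ := ((hE₂.contDiffAt (hU.mem_nhds ha)).differentiableAt (by simp)).hasFDerivAt
    have hD := ((hψ a ha).cos.smul hD₁).sub ((hψ a ha).sin.smul hD₂)
    have hDv : fderiv ℝ (fun a => Real.cos (ψ a) • E₁ a - Real.sin (ψ a) • E₂ a) a v =
        Real.cos (ψ a) • fderiv ℝ E₁ a v -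
          (Real.sin (ψ a) * inner ℝ (E₂ a) (fderiv ℝ E₁ a v)) • E₁ a -
          (Real.sin (ψ a) • fderiv ℝ E₂ a v +
            (Real.cos (ψ a) * inner ℝ (E₂ a) (fderiv ℝ E₁ a v)) • E₂ a) := by
      refine (congrArg (fun L : Plane →L[ℝ] Space => L v) hD.fderiv).trans ?_
      simp [sub_eq_add_neg]
    have h1 := d11 a ha v
    have h2 := d22 a ha v
    have h12 := d12 a ha v
    have j21 := i12 a ha
    rw [real_inner_comm] at j21
    rw [real_inner_comm] at h1
    rw [real_inner_comm] at h2
    rw [hDv]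
    simp only [inner_add_left, inner_add_right, inner_sub_left,
      real_inner_smul_left, real_inner_smul_right, i11 a ha, i22 a ha, i12 a ha, j21]
    have h21 : (inner ℝ (fderiv ℝ E₂ a v) (E₁ a) : ℝ) = - inner ℝ (fderiv ℝ E₁ a v) (E₂ a) := by
      rw [real_inner_comm]; linarith
    have h10 : (inner ℝ (fderiv ℝ E₁ a v) (E₁ a) : ℝ) = 0 := by linarith
    have h20 : (inner ℝ (fderiv ℝ E₂ a v) (E₂ a) : ℝ) = 0 := by linarith
    rw [h21, h10, h20, real_inner_comm (fderiv ℝ E₁ a v) (E₂ a)]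
    ring

/-- A flat parametrized surface has Cartesian coordinates `Φ`. -/
theorem exists_flat_coordinates (hU : IsOpen U) (hconv : Convex ℝ U) (hX : ContDiffOn ℝ ∞ X U)
    (hN : ContDiffOn ℝ ∞ N U) (hinj : ∀ a ∈ U, Function.Injective (fderiv ℝ X a))
    (hNN : ∀ a ∈ U, inner ℝ (N a) (N a) = (1 : ℝ))
    (hXN : ∀ a ∈ U, ∀ v, inner ℝ (fderiv ℝ X a v) (N a) = (0 : ℝ))
    (hdet : ∀ a ∈ U, shapeCoeff X N a 0 0 * shapeCoeff X N a 1 1 =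
      shapeCoeff X N a 0 1 * shapeCoeff X N a 1 0) :
    ∃ (Φ : Plane → Plane) (F₁ F₂ : Plane → Space), ContDiffOn ℝ ∞ Φ U ∧
      ∀ a ∈ U, Orthonormal ℝ ![F₁ a, F₂ a, N a] ∧
        0 < (inner ℝ (F₁ a) (cross (F₂ a) (N a)) : ℝ) ∧
        ∀ v, fderiv ℝ X a v = (fderiv ℝ Φ a v) 0 • F₁ a + (fderiv ℝ Φ a v) 1 • F₂ a := by
  obtain ⟨F₁, F₂, hF₁, hF₂, hF⟩ := exists_parallel_frame hU hconv hX hN hinj hNN hXN hdet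
  have i11 : ∀ a ∈ U, inner ℝ (F₁ a) (F₁ a) = (1 : ℝ) := fun a ha =>
    (inner_of_orthonormal (hF a ha).1).1
  have i22 : ∀ a ∈ U, inner ℝ (F₂ a) (F₂ a) = (1 : ℝ) := fun a ha =>
    (inner_of_orthonormal (hF a ha).1).2.1
  have i12 : ∀ a ∈ U, inner ℝ (F₁ a) (F₂ a) = (0 : ℝ) := fun a ha =>
    (inner_of_orthonormal (hF a ha).1).2.2.1
  have hNX : ∀ a ∈ U, ∀ v, inner ℝ (N a) (fderiv ℝ X a v) = (0 : ℝ) := fun a ha v => by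
    rw [real_inner_comm]; exact hXN a ha v
  have p1 : ∀ a ∈ U, ∀ v w, inner ℝ (fderiv ℝ F₁ a v) (fderiv ℝ X a w) = (0 : ℝ) := by
    intro a ha v w
    have h := inner_fderiv_add_eq_zero hU hF₁ hF₁ i11 ha v
    rw [real_inner_comm] at h
    rw [inner_eq_of_orthonormal (hF a ha).1, (hF a ha).2.2, hNX a ha]
    linear_combination (1 / 2 : ℝ) * inner ℝ (F₁ a) (fderiv ℝ X a w) * h
  have p2 : ∀ a ∈ U, ∀ v w, inner ℝ (fderiv ℝ F₂ a v) (fderiv ℝ X a w) = (0 : ℝ) := by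
    intro a ha v w
    have h := inner_fderiv_add_eq_zero hU hF₂ hF₂ i22 ha v
    have h' := inner_fderiv_add_eq_zero hU hF₁ hF₂ i12 ha v
    rw [real_inner_comm] at h h'
    rw [(hF a ha).2.2] at h'
    rw [inner_eq_of_orthonormal (hF a ha).1, hNX a ha]
    linear_combination (1 / 2 : ℝ) * inner ℝ (F₂ a) (fderiv ℝ X a w) * h +
      inner ℝ (F₁ a) (fderiv ℝ X a w) * h'
  -- Since `dF₁` and `dF₂` are normal to the surface, the coframe forms `⟨Fᵢ, dX⟩` are closed; their
  -- potentials are the Cartesian coordinates.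
  obtain ⟨x, hxs, hx⟩ := exists_potential_inner_fderiv hU hconv hX hF₁
    (fun a ha v w => by rw [p1 a ha, p1 a ha])
  obtain ⟨y, hys, hy⟩ := exists_potential_inner_fderiv hU hconv hX hF₂
    (fun a ha v w => by rw [p2 a ha, p2 a ha])
  have hΦ : ContDiffOn ℝ ∞ (fun a => !₂[x a, y a] : Plane → Plane) U := by
    rw [contDiffOn_euclidean]
    intro i
    fin_cases i
    · exact hxs
    · exact hys
  refine ⟨_, F₁, F₂, hΦ, fun a ha => ⟨(hF a ha).1, (hF a ha).2.1, fun v => ?_⟩⟩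
  have hd := ((hΦ.contDiffAt (hU.mem_nhds ha)).differentiableAt (by simp)).hasFDerivAt
  have hi : ∀ i : Fin 2, HasFDerivAt (fun b => (!₂[x b, y b] : Plane) i)
      ((EuclideanSpace.proj i : Plane →L[ℝ] ℝ).comp
        (fderiv ℝ (fun a => (!₂[x a, y a] : Plane)) a)) a :=
    fun i => (EuclideanSpace.proj i : Plane →L[ℝ] ℝ).hasFDerivAt.comp a hd
  have h0 := congrArg (fun L : Plane →L[ℝ] ℝ => L v) ((hi 0).unique (hx a ha))
  have h1 := congrArg (fun L : Plane →L[ℝ] ℝ => L v) ((hi 1).unique (hy a ha))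
  simp at h0 h1
  rw [h0, h1]
  conv_lhs => rw [eq_of_orthonormal (hF a ha).1 (fderiv ℝ X a v), hNX a ha]
  simp

end FlatCoordinates

end FlatSurface

namespace FlatSurface

/-! ### Charts that are isometries onto plane domains -/

section FlatChart

variable {M : Type*} [TopologicalSpace M] [ChartedSpace Plane M]
  {φ η : M → Space}

/-- A chart in which the differential of `φ` sends the standard basis of the plane to a positively
oriented orthonormal frame. -/
structure IsFlatChart (φ η : M → Space) (e : OpenPartialHomeomorph M Plane) : Prop where
  mem_maximalAtlas : e ∈ IsManifold.maximalAtlas (𝓡 2) ∞ M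
  frame : ∀ a ∈ e.target, ∃ f₁ f₂ : Space, Orthonormal ℝ ![f₁, f₂, η (e.symm a)] ∧
    0 < (inner ℝ f₁ (cross f₂ (η (e.symm a))) : ℝ) ∧
    ∀ v : Plane, fderiv ℝ (φ ∘ e.symm) a v = v 0 • f₁ + v 1 • f₂

theorem inner_normal_eq_one (hη : IsUnitNormal φ η) (p : M) : inner ℝ (η p) (η p) = (1 : ℝ) := by
  rw [real_inner_self_eq_norm_sq, hη.norm_eq_one]; norm_num

/-- A flat surface admits Cartesian coordinates around each point. -/
theorem exists_isFlatChart [IsManifold (𝓡 2) ∞ M] (hφ : IsSmoothImmersion φ) (hη : IsUnitNormal φ η)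
    (hflat : ∀ p, gaussCurvature φ η p = 0) (p : M) :
    ∃ e : OpenPartialHomeomorph M Plane, IsFlatChart φ η e ∧ p ∈ e.source := by
  set e₀ := chartAt Plane p with he₀def
  have he₀ : e₀ ∈ IsManifold.maximalAtlas (𝓡 2) ∞ M := IsManifold.chart_mem_maximalAtlas p
  have hp : p ∈ e₀.source := mem_chart_source Plane p
  obtain ⟨r, hr, hball⟩ := Metric.isOpen_iff.1 e₀.open_target _ (e₀.map_source hp)
  set U := Metric.ball (e₀ p) r with hUdef
  have hU : IsOpen U := Metric.isOpen_ball
  have hX := (contDiffOn_comp_symm he₀ hφ.smooth).mono hball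
  have hN := (contDiffOn_comp_symm he₀ hη.smooth).mono hball
  have hinj : ∀ a ∈ U, Function.Injective (fderiv ℝ (φ ∘ e₀.symm) a) := by
    intro a ha v w hvw
    rw [fderiv_comp_symm he₀ hφ.smooth (hball ha), fderiv_comp_symm he₀ hφ.smooth (hball ha)] at hvw
    exact mfderiv_symm_injective he₀ (hball ha) (hφ.injective_diff _ hvw)
  obtain ⟨Φ, F₁, F₂, hΦ, hF⟩ := exists_flat_coordinates hU (convex_ball _ _) hX hN hinj
    (fun a _ => inner_normal_eq_one hη _)
    (fun a ha v => by
      rw [fderiv_comp_symm he₀ hφ.smooth (hball ha)]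
      exact hη.normal _ _)
    (fun a ha => det_shapeCoeff_eq_zero he₀ hφ hη (hball ha) (hflat _))
  have hΦinj : ∀ a ∈ U, Function.Injective (fderiv ℝ Φ a) := by
    intro a ha v w hvw
    apply hinj a ha
    rw [(hF a ha).2.2, (hF a ha).2.2, hvw]
  obtain ⟨g, hg₀, hgU, hgΦ, hg, hg'⟩ := exists_localDiffeo hU hΦ hΦinj (Metric.mem_ball_self hr)
  refine ⟨e₀.trans g, ⟨trans_mem_maximalAtlas he₀ hg hg', fun b hb => ?_⟩, ?_⟩
  · rw [OpenPartialHomeomorph.trans_target] at hb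
    have hbU := hgU (g.map_target hb.1)
    have hG : DifferentiableAt ℝ g.symm b :=
      (hg'.contDiffAt (g.open_target.mem_nhds hb.1)).differentiableAt (by simp)
    have hΦd : DifferentiableAt ℝ Φ (g.symm b) :=
      (hΦ.contDiffAt (hU.mem_nhds hbU)).differentiableAt (by simp)
    have hXd : DifferentiableAt ℝ (φ ∘ e₀.symm) (g.symm b) :=
      (hX.contDiffAt (hU.mem_nhds hbU)).differentiableAt (by simp)
    refine ⟨F₁ (g.symm b), F₂ (g.symm b), (hF _ hbU).1, (hF _ hbU).2.1, fun v => ?_⟩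
    have h1 : fderiv ℝ (φ ∘ (e₀.trans g).symm) b v =
        fderiv ℝ (φ ∘ e₀.symm) (g.symm b) (fderiv ℝ g.symm b v) :=
      congrArg (fun L : Plane →L[ℝ] Space => L v) (fderiv_comp b hXd hG)
    have h2 : fderiv ℝ Φ (g.symm b) (fderiv ℝ g.symm b v) = v := by
      have h3 : Φ ∘ g.symm =ᶠ[nhds b] id :=
        Filter.eventually_of_mem (g.open_target.mem_nhds hb.1) fun x hx => by
          rw [Function.comp_apply, ← hgΦ]; exact g.right_inv hx
      have h4 := fderiv_comp b hΦd hG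
      rw [h3.fderiv_eq, fderiv_id] at h4
      exact (congrArg (fun L : Plane →L[ℝ] Plane => L v) h4).symm
    rw [h1, (hF _ hbU).2.2, h2]
  · rw [OpenPartialHomeomorph.trans_source]
    exact ⟨hp, hg₀⟩

variable {e : OpenPartialHomeomorph M Plane}

theorem IsFlatChart.inner_fderiv (he : IsFlatChart φ η e) {a : Plane} (ha : a ∈ e.target)
    (v w : Plane) :
    (inner ℝ (fderiv ℝ (φ ∘ e.symm) a v) (fderiv ℝ (φ ∘ e.symm) a w) : ℝ) =
      v 0 * w 0 + v 1 * w 1 := by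
  obtain ⟨f₁, f₂, hf, -, hD⟩ := he.frame a ha
  obtain ⟨h11, h22, h12, -, -⟩ := inner_of_orthonormal hf
  have h21 := h12
  rw [real_inner_comm] at h21
  simp only [hD, inner_add_left, inner_add_right, real_inner_smul_left, real_inner_smul_right,
    h11, h22, h12, h21]
  ring

theorem IsFlatChart.metric_coordVec (he : IsFlatChart φ η e) (hφ : IsSmoothImmersion φ) {a : Plane}
    (ha : a ∈ e.target) (i j : Fin 2) :
    metric φ (e.symm a) (coordVec e a i) (coordVec e a j) = if i = j then 1 else 0 := by
  rw [metric, ← fderiv_comp_symm_planeVec he.mem_maximalAtlas hφ.smooth ha,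
    ← fderiv_comp_symm_planeVec he.mem_maximalAtlas hφ.smooth ha, he.inner_fderiv ha]
  fin_cases i <;> fin_cases j <;> simp [planeVec]

/-- The conformal factor is 1; this makes the holomorphy of `Q` available in Cartesian coordinates.
-/
theorem IsFlatChart.isIsothermal (he : IsFlatChart φ η e) (hφ : IsSmoothImmersion φ) :
    IsIsothermal φ η e := by
  refine ⟨he.mem_maximalAtlas, fun a ha => ⟨1, one_pos, fun i j => ?_⟩, fun a ha => ?_⟩
  · rw [he.metric_coordVec hφ ha]; simp
  · rw [det_eq_inner_cross, ← fderiv_comp_symm_planeVec he.mem_maximalAtlas hφ.smooth ha,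
      ← fderiv_comp_symm_planeVec he.mem_maximalAtlas hφ.smooth ha]
    obtain ⟨f₁, f₂, -, hpos, hD⟩ := he.frame a ha
    simpa [hD, planeVec] using hpos

end FlatChart

end FlatSurface

namespace FlatSurface

/-! ### Gauss, Weingarten and Codazzi equations in flat coordinates -/

section FlatPatch

/-- A surface patch `Y` with unit normal `N`, isometrically parametrized by a domain `D` of the
complex plane. -/
structure IsFlatPatch (Y N : ℂ → Space) (D : Set ℂ) : Prop where
  isOpen : IsOpen D
  contDiffOn : ContDiffOn ℝ ∞ Y D
  contDiffOn_normal : ContDiffOn ℝ ∞ N D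
  inner_fderiv : ∀ z ∈ D, ∀ v w : ℂ,
    (inner ℝ (fderiv ℝ Y z v) (fderiv ℝ Y z w) : ℝ) = v.re * w.re + v.im * w.im
  normal : ∀ z ∈ D, ∀ v, inner ℝ (fderiv ℝ Y z v) (N z) = (0 : ℝ)
  inner_normal_self : ∀ z ∈ D, inner ℝ (N z) (N z) = (1 : ℝ)

/-- The second fundamental form `⟨A v, w⟩` of a patch. -/
noncomputable def secondCoeff (Y N : ℂ → Space) (z v w : ℂ) : ℝ :=
  - inner ℝ (fderiv ℝ N z v) (fderiv ℝ Y z w)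

variable {Y N : ℂ → Space} {D : Set ℂ}

namespace IsFlatPatch

theorem contDiffOn_fderiv_apply (h : IsFlatPatch Y N D) (w : ℂ) :
    ContDiffOn ℝ ∞ (fun z => fderiv ℝ Y z w) D :=
  ((contDiffOn_infty_iff_fderiv_of_isOpen h.isOpen).1 h.contDiffOn).2.clm_apply contDiffOn_const

theorem contDiffOn_fderiv_normal_apply (h : IsFlatPatch Y N D) (w : ℂ) :
    ContDiffOn ℝ ∞ (fun z => fderiv ℝ N z w) D :=
  ((contDiffOn_infty_iff_fderiv_of_isOpen h.isOpen).1 h.contDiffOn_normal).2.clm_apply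
    contDiffOn_const

theorem hasFDerivAt (h : IsFlatPatch Y N D) {z : ℂ} (hz : z ∈ D) :
    HasFDerivAt Y (fderiv ℝ Y z) z :=
  ((h.contDiffOn.contDiffAt (h.isOpen.mem_nhds hz)).differentiableAt (by simp)).hasFDerivAt

theorem hasFDerivAt_normal (h : IsFlatPatch Y N D) {z : ℂ} (hz : z ∈ D) :
    HasFDerivAt N (fderiv ℝ N z) z :=
  ((h.contDiffOn_normal.contDiffAt (h.isOpen.mem_nhds hz)).differentiableAt
    (by simp)).hasFDerivAt

theorem hasFDerivAt_fderiv (h : IsFlatPatch Y N D) {z : ℂ} (hz : z ∈ D) :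
    HasFDerivAt (fderiv ℝ Y) (fderiv ℝ (fderiv ℝ Y) z) z :=
  ((((contDiffOn_infty_iff_fderiv_of_isOpen h.isOpen).1 h.contDiffOn).2.contDiffAt
    (h.isOpen.mem_nhds hz)).differentiableAt (by simp)).hasFDerivAt

theorem hasFDerivAt_fderiv_normal (h : IsFlatPatch Y N D) {z : ℂ} (hz : z ∈ D) :
    HasFDerivAt (fderiv ℝ N) (fderiv ℝ (fderiv ℝ N) z) z :=
  ((((contDiffOn_infty_iff_fderiv_of_isOpen h.isOpen).1 h.contDiffOn_normal).2.contDiffAt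
    (h.isOpen.mem_nhds hz)).differentiableAt (by simp)).hasFDerivAt

theorem fderiv_fderiv_apply (h : IsFlatPatch Y N D) {z : ℂ} (hz : z ∈ D) (v w : ℂ) :
    fderiv ℝ (fun z => fderiv ℝ Y z w) z v = fderiv ℝ (fderiv ℝ Y) z v w := by
  rw [fderiv_clm_apply (h.hasFDerivAt_fderiv hz).differentiableAt (by fun_prop)]
  simp

theorem fderiv_fderiv_normal_apply (h : IsFlatPatch Y N D) {z : ℂ} (hz : z ∈ D) (v w : ℂ) :
    fderiv ℝ (fun z => fderiv ℝ N z w) z v = fderiv ℝ (fderiv ℝ N) z v w := by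
  rw [fderiv_clm_apply (h.hasFDerivAt_fderiv_normal hz).differentiableAt (by fun_prop)]
  simp

theorem fderiv_fderiv_symm (h : IsFlatPatch Y N D) {z : ℂ} (hz : z ∈ D) (v w : ℂ) :
    fderiv ℝ (fderiv ℝ Y) z v w = fderiv ℝ (fderiv ℝ Y) z w v :=
  (h.contDiffOn.contDiffAt (h.isOpen.mem_nhds hz)).isSymmSndFDerivAt
    (by simp; exact WithTop.coe_le_coe.2 le_top) v w

theorem fderiv_fderiv_normal_symm (h : IsFlatPatch Y N D) {z : ℂ} (hz : z ∈ D) (v w : ℂ) :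
    fderiv ℝ (fderiv ℝ N) z v w = fderiv ℝ (fderiv ℝ N) z w v :=
  (h.contDiffOn_normal.contDiffAt (h.isOpen.mem_nhds hz)).isSymmSndFDerivAt
    (by simp; exact WithTop.coe_le_coe.2 le_top) v w

theorem orthonormal (h : IsFlatPatch Y N D) {z : ℂ} (hz : z ∈ D) :
    Orthonormal ℝ ![fderiv ℝ Y z 1, fderiv ℝ Y z Complex.I, N z] := by
  apply orthonormal_triple <;>
    simp only [h.inner_fderiv z hz, h.normal z hz, h.inner_normal_self z hz] <;> simp

theorem inner_normal_fderiv_fderiv (h : IsFlatPatch Y N D) {z : ℂ} (hz : z ∈ D) (v w : ℂ) :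
    inner ℝ (N z) (fderiv ℝ (fderiv ℝ Y) z v w) = secondCoeff Y N z v w := by
  have := inner_fderiv_add_eq_zero h.isOpen (h.contDiffOn_fderiv_apply w) h.contDiffOn_normal
    (c := 0) (fun z hz => h.normal z hz w) hz v
  rw [h.fderiv_fderiv_apply hz, real_inner_comm, real_inner_comm (N z)] at this
  rw [secondCoeff]; linarith

theorem secondCoeff_symm (h : IsFlatPatch Y N D) {z : ℂ} (hz : z ∈ D) (v w : ℂ) :
    secondCoeff Y N z v w = secondCoeff Y N z w v := by
  rw [← h.inner_normal_fderiv_fderiv hz, ← h.inner_normal_fderiv_fderiv hz,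
    h.fderiv_fderiv_symm hz]

/-- Gauss' formula in flat coordinates. -/
theorem fderiv_fderiv_eq (h : IsFlatPatch Y N D) {z : ℂ} (hz : z ∈ D) (v w : ℂ) :
    fderiv ℝ (fderiv ℝ Y) z v w = secondCoeff Y N z v w • N z := by
  have key : ∀ v w u, (inner ℝ (fderiv ℝ Y z w) (fderiv ℝ (fderiv ℝ Y) z v u) : ℝ) +
      inner ℝ (fderiv ℝ Y z u) (fderiv ℝ (fderiv ℝ Y) z v w) = 0 := by
    intro v w u
    have := inner_fderiv_add_eq_zero h.isOpen (h.contDiffOn_fderiv_apply w)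
      (h.contDiffOn_fderiv_apply u) (fun z hz => h.inner_fderiv z hz w u) hz v
    rw [h.fderiv_fderiv_apply hz, h.fderiv_fderiv_apply hz] at this
    rw [real_inner_comm _ (fderiv ℝ Y z u)]
    exact this
  -- The Koszul argument: the trilinear quantity is symmetric in one pair of arguments and, the
  -- metric being constant, antisymmetric in another, so it vanishes.
  have hz0 : ∀ u, (inner ℝ (fderiv ℝ Y z u) (fderiv ℝ (fderiv ℝ Y) z v w) : ℝ) = 0 := by
    intro u
    have h1 := key v w u
    have h2 := key w u v
    have h3 := key u v w
    rw [h.fderiv_fderiv_symm hz w u] at h2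
    rw [h.fderiv_fderiv_symm hz w v] at h2
    rw [h.fderiv_fderiv_symm hz u v] at h3
    linarith
  rw [eq_of_orthonormal (h.orthonormal hz) (fderiv ℝ (fderiv ℝ Y) z v w), hz0, hz0,
    h.inner_normal_fderiv_fderiv hz]
  simp

theorem inner_normal_fderiv_normal (h : IsFlatPatch Y N D) {z : ℂ} (hz : z ∈ D) (v : ℂ) :
    inner ℝ (N z) (fderiv ℝ N z v) = (0 : ℝ) := by
  have := inner_fderiv_add_eq_zero h.isOpen h.contDiffOn_normal h.contDiffOn_normal
    h.inner_normal_self hz v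
  rw [real_inner_comm (N z)] at this
  linarith

/-- Weingarten's formula in flat coordinates. -/
theorem fderiv_normal_eq (h : IsFlatPatch Y N D) {z : ℂ} (hz : z ∈ D) (v : ℂ) :
    fderiv ℝ N z v = -(secondCoeff Y N z v 1 • fderiv ℝ Y z 1 +
      secondCoeff Y N z v Complex.I • fderiv ℝ Y z Complex.I) := by
  rw [eq_of_orthonormal (h.orthonormal hz) (fderiv ℝ N z v), h.inner_normal_fderiv_normal hz,
    real_inner_comm, real_inner_comm _ (fderiv ℝ Y z Complex.I), secondCoeff, secondCoeff]
  module

theorem contDiffOn_secondCoeff (h : IsFlatPatch Y N D) (v w : ℂ) :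
    ContDiffOn ℝ ∞ (fun z => secondCoeff Y N z v w) D :=
  ((h.contDiffOn_fderiv_normal_apply v).inner ℝ (h.contDiffOn_fderiv_apply w)).neg

/-- The Codazzi equation in flat coordinates. -/
theorem codazzi (h : IsFlatPatch Y N D) {z : ℂ} (hz : z ∈ D) (u v w : ℂ) :
    fderiv ℝ (fun z => secondCoeff Y N z v w) z u =
      fderiv ℝ (fun z => secondCoeff Y N z u w) z v := by
  -- The term `⟨dN, D²Y⟩` drops out because `D²Y` is normal and `dN` tangential; Codazzi is then the
  -- symmetry of `D²N`.
  have key : ∀ u v, fderiv ℝ (fun z => secondCoeff Y N z v w) z u =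
      - inner ℝ (fderiv ℝ (fderiv ℝ N) z u v) (fderiv ℝ Y z w) := by
    intro u v
    have h1 := ((h.contDiffOn_fderiv_normal_apply v).contDiffAt
      (h.isOpen.mem_nhds hz)).differentiableAt (by simp)
    have h2 := ((h.contDiffOn_fderiv_apply w).contDiffAt
      (h.isOpen.mem_nhds hz)).differentiableAt (by simp)
    have h3 := fderiv_inner_apply ℝ h1 h2 u
    rw [h.fderiv_fderiv_apply hz, h.fderiv_fderiv_normal_apply hz, h.fderiv_fderiv_eq hz,
      real_inner_smul_right, real_inner_comm, h.inner_normal_fderiv_normal hz, mul_zero,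
      zero_add] at h3
    rw [← h3]
    simp only [secondCoeff]
    rw [fderiv_fun_neg]
    rfl
  rw [key, key, h.fderiv_fderiv_normal_symm hz]

theorem secondCoeff_smul_add (z v w₁ w₂ : ℂ) (s t : ℝ) :
    secondCoeff Y N z v (s • w₁ + t • w₂) =
      s * secondCoeff Y N z v w₁ + t * secondCoeff Y N z v w₂ := by
  simp only [secondCoeff, map_add, map_smul, inner_add_right, real_inner_smul_right]
  ring

end IsFlatPatch

end FlatPatch

end FlatSurface

namespace FlatSurface

/-! ### Integrating the cone form in polar coordinates -/

section Cone

theorem eq_of_hasDerivAt_zero {E : Type*} [NormedAddCommGroup E] [NormedSpace ℝ E] {f : ℝ → E}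
    {x₀ δ : ℝ} (hf : ∀ x ∈ Metric.ball x₀ δ, HasDerivAt f 0 x) {x : ℝ}
    (hx : x ∈ Metric.ball x₀ δ) : f x = f x₀ :=
  Metric.isOpen_ball.is_const_of_deriv_eq_zero (convex_ball x₀ δ).isPreconnected
    (fun y hy => (hf y hy).differentiableAt.differentiableWithinAt)
    (fun y hy => (hf y hy).deriv) hx
    (Metric.mem_ball_self (dist_nonneg.trans_lt (Metric.mem_ball.1 hx)))

theorem eq_of_hasDerivAt_zero₂ {E : Type*} [NormedAddCommGroup E] [NormedSpace ℝ E]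
    {f : ℝ → ℝ → E} {x₀ y₀ δ : ℝ}
    (hf : ∀ x ∈ Metric.ball x₀ δ, ∀ y ∈ Metric.ball y₀ δ,
      HasDerivAt (fun s => f s y) 0 x ∧ HasDerivAt (fun t => f x t) 0 y) {x y : ℝ}
    (hx : x ∈ Metric.ball x₀ δ) (hy : y ∈ Metric.ball y₀ δ) : f x y = f x₀ y₀ := by
  have hx₀ : x₀ ∈ Metric.ball x₀ δ :=
    Metric.mem_ball_self (dist_nonneg.trans_lt (Metric.mem_ball.1 hx))
  rw [eq_of_hasDerivAt_zero (f := fun s => f s y) (fun s hs => (hf s hs y hy).1) hx]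
  exact eq_of_hasDerivAt_zero (f := fun t => f x₀ t) (fun t ht => (hf x₀ hx₀ t ht).2) hy

/-- The Euclidean motion with prescribed image of the origin and of the standard frame. -/
theorem exists_isometry_of_orthonormal {a b c : Space} (h : Orthonormal ℝ ![a, b, c]) (p : Space) :
    ∃ T : Space ≃ᵃⁱ[ℝ] Space, ∀ x y z : ℝ, T !₂[x, y, z] = p + x • a + y • b + z • c := by
  obtain ⟨o, rfl, rfl, rfl⟩ := exists_orthonormalBasis h
  refine ⟨o.repr.symm.toAffineIsometryEquiv.trans (AffineIsometryEquiv.constVAdd ℝ Space p),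
    fun x y z => ?_⟩
  have : o.repr.symm !₂[x, y, z] = x • o 0 + y • o 1 + z • o 2 := by
    rw [← o.sum_repr_symm, Fin.sum_univ_three]; simp
  simp only [AffineIsometryEquiv.coe_trans, Function.comp_apply,
    LinearIsometryEquiv.coe_toAffineIsometryEquiv, AffineIsometryEquiv.coe_constVAdd, this,
    vadd_eq_add]
  abel

/-- The unit vector with argument `u`. -/
noncomputable def unitVec (u : ℝ) : ℂ := ⟨Real.cos u, Real.sin u⟩

theorem unitVec_eq (u : ℝ) : unitVec u = Real.cos u + Real.sin u * Complex.I := by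
  apply Complex.ext <;> simp [unitVec, -Complex.ofReal_cos, -Complex.ofReal_sin]

theorem hasDerivAt_unitVec (u : ℝ) : HasDerivAt unitVec (Complex.I * unitVec u) u := by
  have h := ((Real.hasDerivAt_cos u).ofReal_comp).add
    (((Real.hasDerivAt_sin u).ofReal_comp).mul_const Complex.I)
  have h2 : unitVec = fun u : ℝ => ((Real.cos u : ℝ) : ℂ) + ((Real.sin u : ℝ) : ℂ) * Complex.I :=
    funext unitVec_eq
  rw [h2]
  refine h.congr_deriv ?_
  push_cast
  linear_combination -(Complex.sin u) * Complex.I_sq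

/-- Polar coordinates around `z₀`. -/
noncomputable def polarMap (z₀ : ℂ) (u r : ℝ) : ℂ := z₀ + r * unitVec u

theorem hasDerivAt_polarMap_left (z₀ : ℂ) (u r : ℝ) :
    HasDerivAt (fun u => polarMap z₀ u r) (r * (Complex.I * unitVec u)) u :=
  ((hasDerivAt_unitVec u).const_mul (r : ℂ)).const_add z₀

theorem hasDerivAt_polarMap_right (z₀ : ℂ) (u r : ℝ) :
    HasDerivAt (fun r : ℝ => polarMap z₀ u r) (unitVec u) r := by
  simpa [polarMap] using
    (((hasDerivAt_id r).ofReal_comp).mul_const (unitVec u)).const_add z₀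

theorem norm_unitVec (u : ℝ) : ‖unitVec u‖ = 1 := by
  rw [Complex.norm_def, Complex.normSq_apply]
  simp [unitVec, ← sq]

variable {Y N : ℂ → Space} {D : Set ℂ}

/-- The second fundamental form of a circular cone with vertex at `z₀`, developed on the plane. -/
def HasConeForm (Y N : ℂ → Space) (m : ℝ) (z₀ z : ℂ) : Prop :=
  ∀ v w : ℂ, secondCoeff Y N z v w = m / ‖z - z₀‖ ^ 3 *
    (((z - z₀).re * v.im - (z - z₀).im * v.re) * ((z - z₀).re * w.im - (z - z₀).im * w.re))

/-- Radial directions annihilate the form, and the angle enters only through the polar frame; this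
is what gives the moving frame constant coefficients. -/
theorem HasConeForm.polar {m : ℝ} {z₀ : ℂ} {u r : ℝ} (hr : 0 < r)
    (h : HasConeForm Y N m z₀ (polarMap z₀ u r)) (v w : ℂ) :
    secondCoeff Y N (polarMap z₀ u r) v w = m / r *
      ((Real.cos u * v.im - Real.sin u * v.re) * (Real.cos u * w.im - Real.sin u * w.re)) := by
  have h1 : polarMap z₀ u r - z₀ = r * unitVec u := by simp [polarMap]
  have hre : (r * unitVec u : ℂ).re = r * Real.cos u := by simp [unitVec]
  have him : (r * unitVec u : ℂ).im = r * Real.sin u := by simp [unitVec]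
  rw [h v w, h1, hre, him, norm_mul, norm_unitVec, Complex.norm_real, Real.norm_of_nonneg hr.le]
  field_simp

namespace IsFlatPatch

variable {m : ℝ} {z₀ : ℂ} {u r : ℝ}

/-- Gauss' formula along a curve, in the form used to differentiate the polar frame. -/
theorem hasDerivAt_fderiv_apply (h : IsFlatPatch Y N D) {γ V : ℝ → ℂ} {γ' V' : ℂ} {t : ℝ}
    (hz : γ t ∈ D) (hγ : HasDerivAt γ γ' t) (hV : HasDerivAt V V' t) :
    HasDerivAt (fun t => fderiv ℝ Y (γ t) (V t))
      (secondCoeff Y N (γ t) γ' (V t) • N (γ t) + fderiv ℝ Y (γ t) V') t := by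
  rw [← h.fderiv_fderiv_eq hz]
  exact ((h.hasFDerivAt_fderiv hz).comp_hasDerivAt t hγ).clm_apply hV

theorem fderiv_eq (z v : ℂ) :
    fderiv ℝ Y z v = v.re • fderiv ℝ Y z 1 + v.im • fderiv ℝ Y z Complex.I := by
  rw [← map_smul, ← map_smul, ← map_add]
  congr 1
  apply Complex.ext <;> simp

/-- A patch with the second fundamental form of a circular cone is a circular cone. -/
theorem exists_cone (h : IsFlatPatch Y N D) (hcone : ∀ z ∈ D, HasConeForm Y N m z₀ z)
    {u₀ r₀ : ℝ} (hr₀ : 0 < r₀) (hD : polarMap z₀ u₀ r₀ ∈ D) :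
    ∃ α β k : ℝ, α ^ 2 + k ^ 2 * β ^ 2 = k ^ 2 ∧ α ≠ 0 ∧ ∃ T : Space ≃ᵃⁱ[ℝ] Space, ∃ δ > 0,
      ∀ u ∈ Metric.ball u₀ δ, ∀ r ∈ Metric.ball r₀ δ, 0 < r ∧ polarMap z₀ u r ∈ D ∧
        Y (polarMap z₀ u r) = T (cone α β k u (r - 1)) := by
  have hcont : Continuous fun p : ℝ × ℝ => polarMap z₀ p.1 p.2 := by
    have : Continuous unitVec :=
      continuous_iff_continuousAt.2 fun u => (hasDerivAt_unitVec u).continuousAt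
    unfold polarMap
    fun_prop
  have hopen : IsOpen {p : ℝ × ℝ | 0 < p.2 ∧ polarMap z₀ p.1 p.2 ∈ D} :=
    (isOpen_lt continuous_const continuous_snd).inter (h.isOpen.preimage hcont)
  obtain ⟨δ, hδ, hball⟩ := Metric.isOpen_iff.1 hopen (u₀, r₀) ⟨hr₀, hD⟩
  have hdom : ∀ u ∈ Metric.ball u₀ δ, ∀ r ∈ Metric.ball r₀ δ, 0 < r ∧ polarMap z₀ u r ∈ D := by
    intro u hu r hr
    exact hball (by rw [← ball_prod_same]; exact ⟨hu, hr⟩ : (u, r) ∈ _)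
  set Er : ℝ → ℝ → Space := fun u r => fderiv ℝ Y (polarMap z₀ u r) (unitVec u) with hEr
  set Et : ℝ → ℝ → Space := fun u r => fderiv ℝ Y (polarMap z₀ u r) (Complex.I * unitVec u)
    with hEt
  set Nu : ℝ → ℝ → Space := fun u r => N (polarMap z₀ u r) with hNu
  have hIre : ∀ u, (Complex.I * unitVec u).re = - Real.sin u := fun u => by simp [unitVec]
  have hIim : ∀ u, (Complex.I * unitVec u).im = Real.cos u := fun u => by simp [unitVec]
  have hrIre : ∀ u (r : ℝ), (r * (Complex.I * unitVec u)).re = - (r * Real.sin u) := fun u r => by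
    simp [unitVec]
  have hrIim : ∀ u (r : ℝ), (r * (Complex.I * unitVec u)).im = r * Real.cos u := fun u r => by
    simp [unitVec]
  have hre : ∀ u, (unitVec u).re = Real.cos u := fun u => rfl
  have him : ∀ u, (unitVec u).im = Real.sin u := fun u => rfl
  have hIV : ∀ u, HasDerivAt (fun u => Complex.I * unitVec u) (- unitVec u) u := fun u => by
    refine HasDerivAt.congr_deriv ((hasDerivAt_unitVec u).const_mul Complex.I) (Eq.symm ?_)
    rw [← mul_assoc, Complex.I_mul_I]; ring
  have hII : ∀ u (r : ℝ), fderiv ℝ Y (polarMap z₀ u r) (r * (Complex.I * unitVec u)) =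
      r • Et u r := fun u r => by
    rw [hEt, ← map_smul]; rfl
  have hcs : ∀ u, Real.sin u ^ 2 + Real.cos u ^ 2 = 1 := Real.sin_sq_add_cos_sq
  have dY : ∀ u ∈ Metric.ball u₀ δ, ∀ r ∈ Metric.ball r₀ δ,
      HasDerivAt (fun s => Y (polarMap z₀ s r)) (r • Et u r) u ∧
      HasDerivAt (fun t => Y (polarMap z₀ u t)) (Er u r) r := by
    intro u hu r hr
    obtain ⟨-, hz⟩ := hdom u hu r hr
    rw [← hII]
    exact ⟨(h.hasFDerivAt hz).comp_hasDerivAt u (hasDerivAt_polarMap_left z₀ u r),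
      (h.hasFDerivAt hz).comp_hasDerivAt r (hasDerivAt_polarMap_right z₀ u r)⟩
  -- The frame is constant along rulings, and in the angle it satisfies `Er' = Et`, `Et' = m N -
  -- Er`, `N' = -m Et`.
  have dEr : ∀ u ∈ Metric.ball u₀ δ, ∀ r ∈ Metric.ball r₀ δ,
      HasDerivAt (fun s => Er s r) (Et u r) u ∧ HasDerivAt (fun t => Er u t) 0 r := by
    intro u hu r hr
    obtain ⟨hr0, hz⟩ := hdom u hu r hr
    constructor
    · refine HasDerivAt.congr_deriv
        (h.hasDerivAt_fderiv_apply (γ := fun u => polarMap z₀ u r) (t := u) hz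
        (hasDerivAt_polarMap_left z₀ u r)
        (hasDerivAt_unitVec u)) (Eq.symm ?_)
      rw [(hcone _ hz).polar hr0, hre, him]
      rw [show Real.cos u * Real.sin u - Real.sin u * Real.cos u = 0 by ring]
      simp [hEt]
    · refine HasDerivAt.congr_deriv
        (h.hasDerivAt_fderiv_apply (γ := fun r => polarMap z₀ u r) (t := r) hz
        (hasDerivAt_polarMap_right z₀ u r)
        (hasDerivAt_const r (unitVec u))) (Eq.symm ?_)
      rw [(hcone _ hz).polar hr0, hre, him]
      rw [show Real.cos u * Real.sin u - Real.sin u * Real.cos u = 0 by ring]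
      simp
  have dEt : ∀ u ∈ Metric.ball u₀ δ, ∀ r ∈ Metric.ball r₀ δ,
      HasDerivAt (fun s => Et s r) (m • Nu u r - Er u r) u ∧
      HasDerivAt (fun t => Et u t) 0 r := by
    intro u hu r hr
    obtain ⟨hr0, hz⟩ := hdom u hu r hr
    constructor
    · refine HasDerivAt.congr_deriv
        (h.hasDerivAt_fderiv_apply (γ := fun u => polarMap z₀ u r) (t := u) hz
        (hasDerivAt_polarMap_left z₀ u r)
        (hIV u)) (Eq.symm ?_)
      rw [(hcone _ hz).polar hr0, hrIre, hrIim, hIre, hIim, map_neg, sub_eq_add_neg]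
      congr 2
      rw [show Real.cos u * (r * Real.cos u) - Real.sin u * -(r * Real.sin u) = r by
          linear_combination r * hcs u,
        show Real.cos u * Real.cos u - Real.sin u * -Real.sin u = 1 by linear_combination hcs u]
      field_simp
    · refine HasDerivAt.congr_deriv
        (h.hasDerivAt_fderiv_apply (γ := fun r => polarMap z₀ u r) (t := r) hz
        (hasDerivAt_polarMap_right z₀ u r)
        (hasDerivAt_const r (Complex.I * unitVec u))) (Eq.symm ?_)
      rw [(hcone _ hz).polar hr0, hre, him]
      rw [show Real.cos u * Real.sin u - Real.sin u * Real.cos u = 0 by ring]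
      simp
  have dN : ∀ u ∈ Metric.ball u₀ δ, ∀ r ∈ Metric.ball r₀ δ,
      HasDerivAt (fun s => Nu s r) (-(m • Et u r)) u ∧ HasDerivAt (fun t => Nu u t) 0 r := by
    intro u hu r hr
    obtain ⟨hr0, hz⟩ := hdom u hu r hr
    constructor
    · refine HasDerivAt.congr_deriv
        ((h.hasFDerivAt_normal hz).comp_hasDerivAt u (hasDerivAt_polarMap_left z₀ u r)) (Eq.symm ?_)
      rw [h.fderiv_normal_eq hz, (hcone _ hz).polar hr0, (hcone _ hz).polar hr0, hrIre, hrIim]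
      simp only [hEt]
      rw [fderiv_eq _ (Complex.I * unitVec u), hIre, hIim]
      rw [show Real.cos u * (r * Real.cos u) - Real.sin u * -(r * Real.sin u) = r by
          linear_combination r * hcs u]
      congr 1
      rw [smul_add, smul_smul, smul_smul]
      congr 2 <;> simp <;> field_simp
    · refine HasDerivAt.congr_deriv
        ((h.hasFDerivAt_normal hz).comp_hasDerivAt r (hasDerivAt_polarMap_right z₀ u r))
        (Eq.symm ?_)
      rw [h.fderiv_normal_eq hz, (hcone _ hz).polar hr0, (hcone _ hz).polar hr0, hre, him]
      rw [show Real.cos u * Real.sin u - Real.sin u * Real.cos u = 0 by ring]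
      simp
  set κ := Real.sqrt (1 + m ^ 2) with hκ
  have hκ2 : κ ^ 2 = 1 + m ^ 2 := Real.sq_sqrt (by positivity)
  have hκ0 : κ ≠ 0 := (Real.sqrt_pos.2 (by positivity)).ne'
  have hu₀ : u₀ ∈ Metric.ball u₀ δ := Metric.mem_ball_self hδ
  have hr₀' : r₀ ∈ Metric.ball r₀ δ := Metric.mem_ball_self hδ
  have dc : ∀ u, HasDerivAt (fun u => Real.cos (κ * u)) (-(κ * Real.sin (κ * u))) u := fun u => by
    refine HasDerivAt.congr_deriv (((hasDerivAt_id u).const_mul κ).cos) (Eq.symm ?_)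
    simp [mul_comm]
  have ds : ∀ u, HasDerivAt (fun u => Real.sin (κ * u)) (κ * Real.cos (κ * u)) u := fun u => by
    refine HasDerivAt.congr_deriv (((hasDerivAt_id u).const_mul κ).sin) (Eq.symm ?_)
    simp [mul_comm]
  -- First integrals: `V` is the vertex, `A` the axis (the kernel of the system), and `C₁`, `C₂`
  -- undo the rotation of the plane orthogonal to `A`, whose angular speed is `κ = √(1 + m²)`.
  set V : ℝ → ℝ → Space := fun u r => Y (polarMap z₀ u r) - r • Er u r with hV
  set A : ℝ → ℝ → Space := fun u r => κ⁻¹ • (m • Er u r + Nu u r) with hA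
  set C₁ : ℝ → ℝ → Space := fun u r =>
    Real.cos (κ * u) • κ⁻¹ • (Er u r - m • Nu u r) - Real.sin (κ * u) • Et u r with hC₁
  set C₂ : ℝ → ℝ → Space := fun u r =>
    Real.sin (κ * u) • κ⁻¹ • (Er u r - m • Nu u r) + Real.cos (κ * u) • Et u r with hC₂
  have cV : ∀ u ∈ Metric.ball u₀ δ, ∀ r ∈ Metric.ball r₀ δ, V u r = V u₀ r₀ := by
    intro u hu r hr
    refine eq_of_hasDerivAt_zero₂ (fun u hu r hr => ⟨?_, ?_⟩) hu hr
    · refine HasDerivAt.congr_deriv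
        ((dY u hu r hr).1.sub ((dEr u hu r hr).1.const_smul r)) (Eq.symm ?_)
      simp
    · refine HasDerivAt.congr_deriv
        ((dY u hu r hr).2.sub ((hasDerivAt_id r).smul (dEr u hu r hr).2)) (Eq.symm ?_)
      simp
  have cA : ∀ u ∈ Metric.ball u₀ δ, ∀ r ∈ Metric.ball r₀ δ, A u r = A u₀ r₀ := by
    intro u hu r hr
    refine eq_of_hasDerivAt_zero₂ (fun u hu r hr => ⟨?_, ?_⟩) hu hr
    · refine HasDerivAt.congr_deriv
        ((((dEr u hu r hr).1.const_smul m).add (dN u hu r hr).1).const_smul κ⁻¹) (Eq.symm ?_)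
      simp
    · refine HasDerivAt.congr_deriv
        ((((dEr u hu r hr).2.const_smul m).add (dN u hu r hr).2).const_smul κ⁻¹) (Eq.symm ?_)
      simp
  -- With `P = κ⁻¹ (Er - m N)` the system is the rotation `P' = κ Et`, `Et' = -κ P`.
  have dP : ∀ u ∈ Metric.ball u₀ δ, ∀ r ∈ Metric.ball r₀ δ,
      HasDerivAt (fun s => κ⁻¹ • (Er s r - m • Nu s r)) (κ • Et u r) u ∧
      HasDerivAt (fun t => κ⁻¹ • (Er u t - m • Nu u t)) 0 r := by
    intro u hu r hr
    constructor
    · refine HasDerivAt.congr_deriv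
        (((dEr u hu r hr).1.sub ((dN u hu r hr).1.const_smul m)).const_smul κ⁻¹) (Eq.symm ?_)
      have : κ = κ⁻¹ * (1 + m ^ 2) := by rw [← hκ2]; field_simp
      conv_lhs => rw [this]
      module
    · refine HasDerivAt.congr_deriv
        (((dEr u hu r hr).2.sub ((dN u hu r hr).2.const_smul m)).const_smul κ⁻¹) (Eq.symm ?_)
      simp
  have hEtP : ∀ u r, m • Nu u r - Er u r = -(κ • κ⁻¹ • (Er u r - m • Nu u r)) := fun u r => by
    rw [smul_smul, mul_inv_cancel₀ hκ0]; module
  have cC₁ : ∀ u ∈ Metric.ball u₀ δ, ∀ r ∈ Metric.ball r₀ δ, C₁ u r = C₁ u₀ r₀ := by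
    intro u hu r hr
    refine eq_of_hasDerivAt_zero₂ (fun u hu r hr => ⟨?_, ?_⟩) hu hr
    · refine HasDerivAt.congr_deriv
        (((dc u).smul (dP u hu r hr).1).sub ((ds u).smul (dEt u hu r hr).1)) (Eq.symm ?_)
      rw [hEtP]
      module
    · refine HasDerivAt.congr_deriv (((dP u hu r hr).2.const_smul (Real.cos (κ * u))).sub
        ((dEt u hu r hr).2.const_smul (Real.sin (κ * u)))) (Eq.symm ?_)
      simp
  have cC₂ : ∀ u ∈ Metric.ball u₀ δ, ∀ r ∈ Metric.ball r₀ δ, C₂ u r = C₂ u₀ r₀ := by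
    intro u hu r hr
    refine eq_of_hasDerivAt_zero₂ (fun u hu r hr => ⟨?_, ?_⟩) hu hr
    · refine HasDerivAt.congr_deriv
        (((ds u).smul (dP u hu r hr).1).add ((dc u).smul (dEt u hu r hr).1)) (Eq.symm ?_)
      rw [hEtP]
      module
    · refine HasDerivAt.congr_deriv (((dP u hu r hr).2.const_smul (Real.sin (κ * u))).add
        ((dEt u hu r hr).2.const_smul (Real.cos (κ * u)))) (Eq.symm ?_)
      simp
  have horth : Orthonormal ℝ ![C₁ u₀ r₀, C₂ u₀ r₀, A u₀ r₀] := by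
    have hrr : inner ℝ (Er u₀ r₀) (Er u₀ r₀) = (1 : ℝ) := by
      rw [h.inner_fderiv _ hD, hre, him]; linear_combination hcs u₀
    have htt : inner ℝ (Et u₀ r₀) (Et u₀ r₀) = (1 : ℝ) := by
      rw [h.inner_fderiv _ hD, hIre, hIim]; linear_combination hcs u₀
    have hrt : inner ℝ (Er u₀ r₀) (Et u₀ r₀) = (0 : ℝ) := by
      rw [h.inner_fderiv _ hD, hIre, hIim, hre, him]; ring
    have hrN : inner ℝ (Er u₀ r₀) (Nu u₀ r₀) = (0 : ℝ) := h.normal _ hD _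
    have htN : inner ℝ (Et u₀ r₀) (Nu u₀ r₀) = (0 : ℝ) := h.normal _ hD _
    have hNN : inner ℝ (Nu u₀ r₀) (Nu u₀ r₀) = (1 : ℝ) := h.inner_normal_self _ hD
    have htr := hrt; have hNr := hrN; have hNt := htN
    rw [real_inner_comm] at htr hNr hNt
    have hcs' := hcs (κ * u₀)
    have hκi : κ⁻¹ * κ⁻¹ * (1 + m ^ 2) = 1 := by rw [← hκ2]; field_simp
    set c := Real.cos (κ * u₀)
    set s := Real.sin (κ * u₀)
    apply orthonormal_triple <;>
      simp only [hC₁, hC₂, hA, inner_add_left, inner_add_right, inner_sub_left, inner_sub_right,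
        real_inner_smul_left, real_inner_smul_right, hrr, htt, hrt, hrN, htN, hNN, htr, hNr, hNt]
    · linear_combination c ^ 2 * hκi + hcs'
    · linear_combination s ^ 2 * hκi + hcs'
    · linear_combination hκi
    · linear_combination c * s * hκi
    · ring
    · ring
  -- With `α = -1` and `v = r - 1` the factor `1 - α v` is `r`, while the height is `(m/κ)(r - 1)`;
  -- the extra `(m/κ) A` in the translation makes up the difference.
  obtain ⟨T, hT⟩ := exists_isometry_of_orthonormal horth (V u₀ r₀ + (m / κ) • A u₀ r₀)
  refine ⟨-1, m / κ, κ, ?_, by norm_num, T, δ, hδ, fun u hu r hr => ?_⟩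
  · field_simp
    linear_combination -hκ2
  obtain ⟨hr0, hz⟩ := hdom u hu r hr
  refine ⟨hr0, hz, ?_⟩
  rw [cone, hT, ← cV u hu r hr, ← cA u hu r hr, ← cC₁ u hu r hr, ← cC₂ u hu r hr]
  simp only [hV, hA, hC₁, hC₂]
  have hcs' := hcs (κ * u)
  have hκi : κ⁻¹ * κ⁻¹ * (1 + m ^ 2) = 1 := by rw [← hκ2]; field_simp
  set c := Real.cos (κ * u)
  set s := Real.sin (κ * u)
  have h1 : c * c + s * s = 1 := by linear_combination hcs'
  have h2 : r • Er u r = (r * (κ⁻¹ * κ⁻¹ * (1 + m ^ 2))) • Er u r := by rw [hκi, mul_one]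
  have h3 : Y (polarMap z₀ u r) - r • Er u r + (m / κ) • κ⁻¹ • (m • Er u r + Nu u r) +
      (1 / κ * (1 - -1 * (r - 1)) * c) • (c • κ⁻¹ • (Er u r - m • Nu u r) - s • Et u r) +
      (1 / κ * (1 - -1 * (r - 1)) * s) • (s • κ⁻¹ • (Er u r - m • Nu u r) + c • Et u r) +
      (m / κ * (r - 1)) • κ⁻¹ • (m • Er u r + Nu u r) =
      Y (polarMap z₀ u r) - r • Er u r + (r * κ⁻¹ * κ⁻¹) • ((m ^ 2) • Er u r + m • Nu u r) +
      ((c * c + s * s) * r * κ⁻¹ * κ⁻¹) • (Er u r - m • Nu u r) := by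
    module
  rw [h3, h1, h2]
  module

end IsFlatPatch

end Cone

end FlatSurface

namespace FlatSurface

/-! ### From holomorphic `Q` to the cone form -/

section Holomorphic

/-- A nonvanishing holomorphic function has a holomorphic inverse square root near each point. -/
theorem exists_inv_sqrt {Q : ℂ → ℂ} {D : Set ℂ} (hD : IsOpen D) (hQ : DifferentiableOn ℂ Q D)
    (hQ0 : ∀ z ∈ D, Q z ≠ 0) {p : ℂ} (hp : p ∈ D) :
    ∃ ρ > 0, Metric.ball p ρ ⊆ D ∧ ∃ k : ℂ → ℂ, DifferentiableOn ℂ k (Metric.ball p ρ) ∧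
      ∀ z ∈ Metric.ball p ρ, k z ^ 2 * Q z = 1 := by
  obtain ⟨s, hs⟩ := IsAlgClosed.exists_pow_nat_eq (Q p)⁻¹ (n := 2) two_pos
  -- Near `p` the quotient `Q p / Q z` is close to 1, so the principal logarithm gives a branch of
  -- its square root.
  have hopen : IsOpen (D ∩ (fun z => Q p / Q z) ⁻¹' Complex.slitPlane) :=
    (continuousOn_const.div hQ.continuousOn hQ0).isOpen_inter_preimage hD
      Complex.isOpen_slitPlane
  obtain ⟨ρ, hρ, hball⟩ := Metric.isOpen_iff.1 hopen p
    ⟨hp, by simp [div_self (hQ0 p hp)]⟩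
  refine ⟨ρ, hρ, fun z hz => (hball hz).1, fun z => s * Complex.exp (Complex.log (Q p / Q z) / 2),
    ?_, fun z hz => ?_⟩
  · intro z hz
    obtain ⟨h1, h2⟩ := hball hz
    have hd : DifferentiableAt ℂ Q z := hQ.differentiableAt (hD.mem_nhds h1)
    exact (((((differentiableAt_const _).div hd (hQ0 z h1)).clog h2).div_const 2).cexp.const_mul
      s).differentiableWithinAt
  · obtain ⟨h1, -⟩ := hball hz
    have hq := hQ0 z h1
    have hqp := hQ0 p hp
    rw [mul_pow, hs, ← Complex.exp_nat_mul]
    rw [show ((2 : ℕ) : ℂ) * (Complex.log (Q p / Q z) / 2) = Complex.log (Q p / Q z) by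
      push_cast; ring, Complex.exp_log (div_ne_zero hqp hq)]
    field_simp

/-- A holomorphic function with vanishing real part has vanishing derivative. -/
theorem deriv_eq_zero_of_re_eq_zero {k : ℂ → ℂ} {U : Set ℂ} (hU : IsOpen U)
    (hk : DifferentiableOn ℂ k U) (hre : ∀ z ∈ U, (k z).re = 0) {z : ℂ} (hz : z ∈ U) :
    deriv k z = 0 := by
  have hd := (hk.differentiableAt (hU.mem_nhds hz)).hasDerivAt.hasFDerivAt.restrictScalars ℝ
  have h1 : HasFDerivAt (fun w => (k w).re) _ z := Complex.reCLM.hasFDerivAt.comp z hd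
  have h2 : HasFDerivAt (fun w => (k w).re) (0 : ℂ →L[ℝ] ℝ) z :=
    (hasFDerivAt_const (0 : ℝ) z).congr_of_eventuallyEq
      (Filter.eventually_of_mem (hU.mem_nhds hz) hre)
  have h3 := h1.unique h2
  have h4 := congrArg (fun L : ℂ →L[ℝ] ℝ => L 1) h3
  have h5 := congrArg (fun L : ℂ →L[ℝ] ℝ => L Complex.I) h3
  simp at h4 h5
  exact Complex.ext h4 h5

/-- A rank-one form of positive trace is determined by an inverse square root of its
traceless part. -/
theorem rankOne_eq_of_inv_sqrt {a b c f t s : ℝ} (hf : 0 < f) (htr : a + c = 2 * f)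
    (hdet : a * c = b ^ 2) (h1 : f * ((t ^ 2 - s ^ 2) * (a - c) + 4 * t * s * b) = 2)
    (h2 : f * (t * s * (a - c) - (t ^ 2 - s ^ 2) * b) = 0) :
    f ^ 2 * (t ^ 2 + s ^ 2) = 1 ∧ a = 2 * t ^ 2 * f ^ 3 ∧ b = 2 * t * s * f ^ 3 ∧
      c = 2 * s ^ 2 * f ^ 3 := by
  have hq : ((a - c) / 2) ^ 2 + b ^ 2 = f ^ 2 := by
    rw [← hdet]; linear_combination (1 / 4 : ℝ) * (a + c + 2 * f) * htr
  have h2' : t * s * (a - c) - (t ^ 2 - s ^ 2) * b = 0 :=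
    (mul_eq_zero.1 h2).resolve_left hf.ne'
  -- The squared modulus of `k² · 2Q = 1`, using `|2Q| = f²`.
  have h4 : (f ^ 2 * (t ^ 2 + s ^ 2)) ^ 2 = 1 := by
    have e1 : (f * ((t ^ 2 - s ^ 2) * ((a - c) / 2) + 2 * t * s * b)) ^ 2 = 1 := by
      rw [show f * ((t ^ 2 - s ^ 2) * ((a - c) / 2) + 2 * t * s * b) = 1 by linarith]; norm_num
    linear_combination e1 + f ^ 2 * (t * s * (a - c) - (t ^ 2 - s ^ 2) * b) * h2' -
      f ^ 2 * (t ^ 2 + s ^ 2) ^ 2 * hq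
  have h5 : f ^ 2 * (t ^ 2 + s ^ 2) = 1 := by
    have : 0 ≤ f ^ 2 * (t ^ 2 + s ^ 2) := by positivity
    nlinarith
  -- With the moduli known, `h1` and `h2` form a linear system for the traceless part; the trace
  -- then recovers `a` and `c`.
  have hac : a - c = 2 * (t ^ 2 - s ^ 2) * f ^ 3 := by
    linear_combination -(a - c) * h4 + f ^ 3 * (t ^ 2 - s ^ 2) * h1 + 4 * f ^ 4 * t * s * h2'
  have hb : b = 2 * t * s * f ^ 3 := by
    linear_combination -b * h4 + f ^ 3 * t * s * h1 - f ^ 4 * (t ^ 2 - s ^ 2) * h2'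
  refine ⟨h5, ?_, hb, ?_⟩
  · linear_combination (1 / 2 : ℝ) * htr + (1 / 2 : ℝ) * hac - f * h5
  · linear_combination (1 / 2 : ℝ) * htr - (1 / 2 : ℝ) * hac - f * h5

/-- The first-order consequence of the Codazzi equations for `b = 2 f³ (t, s) ⊗ (t, s)` with
`f² (t² + s²) = 1` and `t + i s` holomorphic with derivative `A + i B`. -/
theorem re_eq_zero_of_codazzi {A B f fx fy t s : ℝ} (hf : 0 < f)
    (hn : f ^ 2 * (t ^ 2 + s ^ 2) = 1)
    (hx : 2 * f * fx * (t ^ 2 + s ^ 2) + f ^ 2 * (2 * t * A + 2 * s * B) = 0)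
    (hy : 2 * f * fy * (t ^ 2 + s ^ 2) + f ^ 2 * (-2 * t * B + 2 * s * A) = 0)
    (h1 : -4 * t * B * f ^ 3 + 6 * t ^ 2 * f ^ 2 * fy =
      2 * (A * s + t * B) * f ^ 3 + 6 * t * s * f ^ 2 * fx)
    (h2 : 2 * (-B * s + t * A) * f ^ 3 + 6 * t * s * f ^ 2 * fy =
      4 * s * B * f ^ 3 + 6 * s ^ 2 * f ^ 2 * fx) : A = 0 := by
  -- The differentiated relation `f² |k|² = 1` expresses `df` through `k'`. After substitution
  -- Codazzi becomes `A s = A t = 0`, and `(t, s) ≠ 0`.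
  have hfx : fx = -f ^ 3 * (t * A + s * B) := by
    refine mul_left_cancel₀ hf.ne' (mul_left_cancel₀ (two_ne_zero (α := ℝ)) ?_)
    linear_combination f ^ 2 * hx - 2 * f * fx * hn
  have hfy : fy = -f ^ 3 * (-t * B + s * A) := by
    refine mul_left_cancel₀ hf.ne' (mul_left_cancel₀ (two_ne_zero (α := ℝ)) ?_)
    linear_combination f ^ 2 * hy - 2 * f * fy * hn
  subst hfx hfy
  have e1 : A * s * f ^ 3 = 0 := by
    linear_combination -(1 / 2 : ℝ) * h1 + 3 * f ^ 3 * t * B * hn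
  have e2 : A * t * f ^ 3 = 0 := by
    linear_combination (1 / 2 : ℝ) * h2 - 3 * f ^ 3 * s * B * hn
  have e3 : f * A = 0 := by linear_combination t * e2 + s * e1 - A * f * hn
  exact (mul_eq_zero.1 e3).resolve_left hf.ne'

/-- All entries of the rank-one form have this shape; the diagonal ones arise from equal factors. -/
theorem fderiv_two_mul_mul_mul_pow {E : Type*} [NormedAddCommGroup E] [NormedSpace ℝ E]
    {b t s f : E → ℝ} {t' s' f' : E →L[ℝ] ℝ} {z : E} (ht : HasFDerivAt t t' z)
    (hs : HasFDerivAt s s' z) (hf : HasFDerivAt f f' z)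
    (hb : b =ᶠ[nhds z] fun w => 2 * t w * s w * f w ^ 3) (v : E) :
    fderiv ℝ b z v = 2 * (t' v * s z + t z * s' v) * f z ^ 3 +
      6 * t z * s z * f z ^ 2 * f' v := by
  have h := ((ht.const_mul 2).mul hs).mul (hf.pow 3)
  rw [hb.fderiv_eq]
  refine (congrArg (fun L : E →L[ℝ] ℝ => L v) h.fderiv).trans ?_
  simp
  ring

variable {Y N : ℂ → Space} {D : Set ℂ}

/-- If `Q` is holomorphic on a flat patch of nonconstant mean curvature, the second fundamental
form is that of a circular cone. -/
theorem IsFlatPatch.exists_hasConeForm (h : IsFlatPatch Y N D)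
    (hdet : ∀ z ∈ D, secondCoeff Y N z 1 1 * secondCoeff Y N z Complex.I Complex.I =
      secondCoeff Y N z 1 Complex.I ^ 2)
    (hpos : ∀ z ∈ D, 0 < secondCoeff Y N z 1 1 + secondCoeff Y N z Complex.I Complex.I)
    (hQ : DifferentiableOn ℂ (fun z =>
      (((secondCoeff Y N z 1 1 + secondCoeff Y N z Complex.I Complex.I) / 2 : ℝ) : ℂ) *
      (secondCoeff Y N z 1 1 - secondCoeff Y N z Complex.I Complex.I - Complex.I *
        (secondCoeff Y N z 1 Complex.I + secondCoeff Y N z Complex.I 1)) / 4) D)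
    {p : ℂ} (hp : p ∈ D)
    (hnc : ¬ ∀ᶠ z in nhds p, secondCoeff Y N z 1 1 + secondCoeff Y N z Complex.I Complex.I =
      secondCoeff Y N p 1 1 + secondCoeff Y N p Complex.I Complex.I) :
    ∃ (m : ℝ) (z₀ : ℂ), ∀ᶠ z in nhds p, z ≠ z₀ ∧ HasConeForm Y N m z₀ z := by
  set f : ℂ → ℝ := fun z =>
    (secondCoeff Y N z 1 1 + secondCoeff Y N z Complex.I Complex.I) / 2 with hf
  have hf0 : ∀ z ∈ D, 0 < f z := fun z hz => half_pos (hpos z hz)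
  have hQeq : ∀ z ∈ D, 2 * ((f z : ℂ) *
      (secondCoeff Y N z 1 1 - secondCoeff Y N z Complex.I Complex.I - Complex.I *
        (secondCoeff Y N z 1 Complex.I + secondCoeff Y N z Complex.I 1)) / 4) =
      ⟨f z * (secondCoeff Y N z 1 1 - secondCoeff Y N z Complex.I Complex.I) / 2,
        - f z * secondCoeff Y N z 1 Complex.I⟩ := by
    intro z hz
    rw [h.secondCoeff_symm hz Complex.I 1]
    apply Complex.ext
    · simp; ring
    · simp; ring
  -- Vanishing of `2Q` would mean `a = c` and `b = 0`, impossible with zero determinant and positive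
  -- trace.
  obtain ⟨ρ, hρ, hsub, k, hk, hkQ⟩ := exists_inv_sqrt h.isOpen (hQ.const_mul 2) (by
    intro z hz h0
    rw [hQeq z hz, Complex.ext_iff] at h0
    have hfz := hf0 z hz
    obtain ⟨h1, h2⟩ := h0
    have h3 : secondCoeff Y N z 1 Complex.I = 0 :=
      (mul_eq_zero.1 h2).resolve_left (neg_ne_zero.2 hfz.ne')
    have h4 : secondCoeff Y N z 1 1 - secondCoeff Y N z Complex.I Complex.I = 0 :=
      (mul_eq_zero.1 ((div_eq_zero_iff.1 h1).resolve_right two_ne_zero)).resolve_left hfz.ne'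
    have h5 := hdet z hz
    have h6 := hpos z hz
    rw [h3] at h5
    nlinarith) hp
  set U := Metric.ball p ρ
  have hU : IsOpen U := Metric.isOpen_ball
  have hform : ∀ z ∈ U, f z ^ 2 * ((k z).re ^ 2 + (k z).im ^ 2) = 1 ∧
      secondCoeff Y N z 1 1 = 2 * (k z).re ^ 2 * f z ^ 3 ∧
      secondCoeff Y N z 1 Complex.I = 2 * (k z).re * (k z).im * f z ^ 3 ∧
      secondCoeff Y N z Complex.I Complex.I = 2 * (k z).im ^ 2 * f z ^ 3 := by
    intro z hz
    have hzD := hsub hz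
    have h1 := hkQ z hz
    rw [hQeq z hzD, Complex.ext_iff] at h1
    obtain ⟨h1, h2⟩ := h1
    simp [sq] at h1 h2
    refine rankOne_eq_of_inv_sqrt (hf0 z hzD) ?_ (hdet z hzD) ?_ ?_
    · simp only [hf]; ring
    · linear_combination 2 * h1
    · linear_combination h2
  have hkd : ∀ z ∈ U, HasDerivAt k (deriv k z) z := fun z hz =>
    (hk.differentiableAt (hU.mem_nhds hz)).hasDerivAt
  have hre : ∀ z ∈ U, (deriv k z).re = 0 := by
    intro z hz
    have hzD := hsub hz
    have hkR := (hkd z hz).hasFDerivAt.restrictScalars ℝ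
    have ht : HasFDerivAt (fun w => (k w).re) _ z := Complex.reCLM.hasFDerivAt.comp z hkR
    have hs : HasFDerivAt (fun w => (k w).im) _ z := Complex.imCLM.hasFDerivAt.comp z hkR
    have hfd : HasFDerivAt f (fderiv ℝ f z) z :=
      ((((h.contDiffOn_secondCoeff 1 1).add (h.contDiffOn_secondCoeff Complex.I
        Complex.I)).div_const 2).contDiffAt (h.isOpen.mem_nhds hzD)).differentiableAt
        (by simp) |>.hasFDerivAt
    have e11 := fderiv_two_mul_mul_mul_pow ht ht hfd
      (Filter.eventually_of_mem (hU.mem_nhds hz) fun w hw => by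
        beta_reduce
        rw [(hform w hw).2.1]; ring : (fun w => secondCoeff Y N w 1 1) =ᶠ[nhds z] _)
    have e12 := fderiv_two_mul_mul_mul_pow ht hs hfd
      (Filter.eventually_of_mem (hU.mem_nhds hz) fun w hw => by
        beta_reduce
        rw [(hform w hw).2.2.1] : (fun w => secondCoeff Y N w 1 Complex.I) =ᶠ[nhds z] _)
    have e21 := fderiv_two_mul_mul_mul_pow ht hs hfd
      (Filter.eventually_of_mem (hU.mem_nhds hz) fun w hw => by
        beta_reduce
        rw [h.secondCoeff_symm (hsub hw), (hform w hw).2.2.1] :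
          (fun w => secondCoeff Y N w Complex.I 1) =ᶠ[nhds z] _)
    have e22 := fderiv_two_mul_mul_mul_pow hs hs hfd
      (Filter.eventually_of_mem (hU.mem_nhds hz) fun w hw => by
        beta_reduce
        rw [(hform w hw).2.2.2]; ring :
          (fun w => secondCoeff Y N w Complex.I Complex.I) =ᶠ[nhds z] _)
    have c1 := h.codazzi hzD Complex.I 1 1
    have c2 := h.codazzi hzD Complex.I 1 Complex.I
    rw [e11, e21] at c1
    rw [e12, e22] at c2
    have en : ∀ v, 2 * f z * fderiv ℝ f z v * ((k z).re ^ 2 + (k z).im ^ 2) + f z ^ 2 *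
        (2 * (k z).re * (deriv k z * v).re + 2 * (k z).im * (deriv k z * v).im) = 0 := by
      intro v
      have h1 := (hfd.pow 2).mul ((ht.pow 2).add (hs.pow 2))
      have h2 : (f ^ 2 * ((fun w => (k w).re) ^ 2 + (fun w => (k w).im) ^ 2)) =ᶠ[nhds z]
          fun _ => (1 : ℝ) :=
        Filter.eventually_of_mem (hU.mem_nhds hz) fun w hw => (hform w hw).1
      have h3 := congrArg (fun L : ℂ →L[ℝ] ℝ => L v)
        (h1.unique ((hasFDerivAt_const (1 : ℝ) z).congr_of_eventuallyEq h2))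
      simp at h3
      simp
      linear_combination h3
    have hx := en 1
    have hy := en Complex.I
    simp at hx hy c1 c2
    refine re_eq_zero_of_codazzi (hf0 z hzD) (hform z hz).1 (B := (deriv k z).im)
      (fx := fderiv ℝ f z 1) (fy := fderiv ℝ f z Complex.I) ?_ ?_ ?_ ?_
    · linear_combination hx
    · linear_combination hy
    · linear_combination c1
    · linear_combination c2
  have hpU : p ∈ U := Metric.mem_ball_self hρ
  have hdk : DifferentiableOn ℂ (deriv k) U := hk.deriv hU
  -- A second use of holomorphy: `k'` is itself holomorphic with zero real part, hence constant on
  -- the ball.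
  have hconst : ∀ z ∈ U, deriv k z = deriv k p := fun z hz =>
    hU.is_const_of_deriv_eq_zero (convex_ball p ρ).isPreconnected hdk
      (fun w hw => deriv_eq_zero_of_re_eq_zero hU hdk hre hw) hz hpU
  set c := (deriv k p).im with hc
  have hkp : deriv k p = Complex.I * c := by
    apply Complex.ext <;> simp [hre p hpU, hc]
  have hlin : ∀ z ∈ U, k z = k p + Complex.I * c * (z - p) := by
    intro z hz
    have hd : ∀ w ∈ U, HasDerivAt (fun w => k w - Complex.I * c * (w - p)) 0 w := by
      intro w hw
      refine ((hkd w hw).sub (((hasDerivAt_id w).sub_const p).const_mul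
        (Complex.I * c))).congr_deriv ?_
      rw [hconst w hw, hkp]; ring
    have := hU.is_const_of_deriv_eq_zero (convex_ball p ρ).isPreconnected
      (fun w hw => (hd w hw).differentiableAt.differentiableWithinAt)
      (fun w hw => (hd w hw).deriv) hz hpU
    simp only [sub_self, mul_zero, sub_zero] at this
    rw [← this]; ring
  -- If `c = 0`, then `k` and therefore `f = 1/|k|` would be constant near `p`.
  have hc0 : c ≠ 0 := by
    intro h0
    apply hnc
    refine Filter.eventually_of_mem (hU.mem_nhds hpU) fun z hz => ?_
    have h1 := (hform z hz).1
    rw [hlin z hz, h0] at h1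
    simp only [Complex.ofReal_zero, mul_zero, zero_mul, add_zero] at h1
    have h2 := (hform p hpU).1
    have hne : (k p).re ^ 2 + (k p).im ^ 2 ≠ 0 := by
      intro h3; rw [h3, mul_zero] at h2; exact zero_ne_one h2
    have h3 : f z ^ 2 = f p ^ 2 := mul_right_cancel₀ hne (h1.trans h2.symm)
    have h4 : f z = f p := (sq_eq_sq₀ (hf0 z (hsub hz)).le (hf0 p hp).le).1 h3
    simp only [hf] at h4
    linarith
  have hcC : (c : ℂ) ≠ 0 := Complex.ofReal_ne_zero.2 hc0
  -- The zero of the affine function `k`; it is the vertex of the developed cone.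
  set z₀ : ℂ := p + Complex.I * k p / c with hz₀
  have hk' : ∀ z ∈ U, k z = Complex.I * c * (z - z₀) := by
    intro z hz
    rw [hlin z hz, hz₀]
    field_simp
    linear_combination k p * Complex.I_sq
  -- The constant comes from the coefficient `2 f³ c²` with `f = 1/(|c| |z - z₀|)`.
  refine ⟨2 / |c|, z₀, Filter.eventually_of_mem (hU.mem_nhds hpU) fun z hz => ?_⟩
  obtain ⟨h1, h11, h12, h22⟩ := hform z hz
  have hkre : (k z).re = -c * (z - z₀).im := by rw [hk' z hz]; simp
  have hkim : (k z).im = c * (z - z₀).re := by rw [hk' z hz]; simp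
  simp only [hkre, hkim] at h1 h11 h12 h22
  have hnorm : ‖z - z₀‖ ^ 2 = (z - z₀).re ^ 2 + (z - z₀).im ^ 2 := by
    rw [Complex.sq_norm, Complex.normSq_apply]; ring
  have hne : z ≠ z₀ := by
    intro h0
    rw [h0] at h1
    simp at h1
  have hnpos : 0 < ‖z - z₀‖ := norm_pos_iff.2 (sub_ne_zero.2 hne)
  have hfn : f z = 1 / (|c| * ‖z - z₀‖) := by
    have hcpos : 0 < |c| := abs_pos.2 hc0
    rw [eq_div_iff (by positivity)]
    have h2 : (f z * (|c| * ‖z - z₀‖)) ^ 2 = 1 := by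
      rw [mul_pow, mul_pow, sq_abs, hnorm, ← h1]; ring
    have h3 : 0 ≤ f z * (|c| * ‖z - z₀‖) := by
      have := hf0 z (hsub hz); positivity
    nlinarith
  have hcoef : 2 * f z ^ 3 * c ^ 2 = 2 / |c| / ‖z - z₀‖ ^ 3 := by
    have hcpos : 0 < |c| := abs_pos.2 hc0
    rw [hfn, ← sq_abs c]
    field_simp
  refine ⟨hne, fun v w => ?_⟩
  have hexp : secondCoeff Y N z v w = v.re * w.re * secondCoeff Y N z 1 1 +
      (v.re * w.im + v.im * w.re) * secondCoeff Y N z 1 Complex.I +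
      v.im * w.im * secondCoeff Y N z Complex.I Complex.I := by
    have hd : ∀ x : ℂ, x = x.re • (1 : ℂ) + x.im • Complex.I := fun x => by
      apply Complex.ext <;> simp
    have hs := h.secondCoeff_symm (hsub hz)
    conv_lhs => rw [hd w, secondCoeff_smul_add, hs v 1, hs v Complex.I, hd v,
      secondCoeff_smul_add, secondCoeff_smul_add, hs Complex.I 1]
    ring
  rw [hexp, h11, h12, h22, ← hcoef]
  ring

end Holomorphic

end FlatSurface

namespace FlatSurface

/-! ### Transfer between charts on `M` and complex coordinates -/

section Assembly

/-- The identification of the complex line with the coordinate plane. -/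
noncomputable def toPlane : ℂ ≃ₗᵢ[ℝ] Plane := Complex.orthonormalBasisOneI.repr

theorem toPlane_apply (z : ℂ) : toPlane z = !₂[z.re, z.im] := by
  ext i; fin_cases i <;> simp [toPlane]

theorem toPlane_one : toPlane 1 = planeVec 0 := by
  rw [toPlane_apply]; ext i; fin_cases i <;> simp [planeVec]

theorem toPlane_I : toPlane Complex.I = planeVec 1 := by
  rw [toPlane_apply]; ext i; fin_cases i <;> simp [planeVec]

theorem fderiv_comp_toPlane (F : Plane → Space) (z v : ℂ) :
    fderiv ℝ (F ∘ toPlane) z v = fderiv ℝ F (toPlane z) (toPlane v) := by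
  have := toPlane.toContinuousLinearEquiv.comp_right_fderiv (f := F) (x := z)
  exact congrArg (fun L : ℂ →L[ℝ] Space => L v) this

theorem shapeCoeff_toPlane (X N : Plane → Space) (z : ℂ) :
    shapeCoeff X N (toPlane z) 0 0 = secondCoeff (X ∘ toPlane) (N ∘ toPlane) z 1 1 ∧
    shapeCoeff X N (toPlane z) 0 1 = secondCoeff (X ∘ toPlane) (N ∘ toPlane) z 1 Complex.I ∧
    shapeCoeff X N (toPlane z) 1 0 = secondCoeff (X ∘ toPlane) (N ∘ toPlane) z Complex.I 1 ∧
    shapeCoeff X N (toPlane z) 1 1 =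
      secondCoeff (X ∘ toPlane) (N ∘ toPlane) z Complex.I Complex.I := by
  simp only [shapeCoeff, secondCoeff, fderiv_comp_toPlane, toPlane_one, toPlane_I, and_self]

theorem IsFlatPatch.mono {Y N : ℂ → Space} {D D' : Set ℂ} (h : IsFlatPatch Y N D)
    (hD' : IsOpen D') (hsub : D' ⊆ D) : IsFlatPatch Y N D' :=
  ⟨hD', h.contDiffOn.mono hsub, h.contDiffOn_normal.mono hsub,
    fun z hz => h.inner_fderiv z (hsub hz), fun z hz => h.normal z (hsub hz),
    fun z hz => h.inner_normal_self z (hsub hz)⟩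

variable {M : Type*} [TopologicalSpace M] [ChartedSpace Plane M]
  {φ η : M → Space} {e : OpenPartialHomeomorph M Plane}

theorem IsFlatChart.isFlatPatch (he : IsFlatChart φ η e) (hφ : IsSmoothImmersion φ)
    (hη : IsUnitNormal φ η) :
    IsFlatPatch ((φ ∘ e.symm) ∘ toPlane) ((η ∘ e.symm) ∘ toPlane) (toPlane ⁻¹' e.target) where
  isOpen := e.open_target.preimage toPlane.continuous
  contDiffOn := (contDiffOn_comp_symm he.mem_maximalAtlas hφ.smooth).comp
    toPlane.toContinuousLinearEquiv.contDiff.contDiffOn fun _ hz => hz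
  contDiffOn_normal := (contDiffOn_comp_symm he.mem_maximalAtlas hη.smooth).comp
    toPlane.toContinuousLinearEquiv.contDiff.contDiffOn fun _ hz => hz
  inner_fderiv z hz v w := by
    rw [fderiv_comp_toPlane, fderiv_comp_toPlane, he.inner_fderiv hz, toPlane_apply v,
      toPlane_apply w]
    simp
  normal z hz v := by
    rw [fderiv_comp_toPlane, fderiv_comp_symm he.mem_maximalAtlas hφ.smooth hz]
    exact hη.normal _ _
  inner_normal_self z _ := inner_normal_eq_one hη _

theorem IsFlatChart.meanCurvature_toPlane (he : IsFlatChart φ η e) (hφ : IsSmoothImmersion φ)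
    (hη : IsUnitNormal φ η) {z : ℂ} (hz : toPlane z ∈ e.target) :
    meanCurvature φ η (e.symm (toPlane z)) =
      (secondCoeff ((φ ∘ e.symm) ∘ toPlane) ((η ∘ e.symm) ∘ toPlane) z 1 1 +
        secondCoeff ((φ ∘ e.symm) ∘ toPlane) ((η ∘ e.symm) ∘ toPlane) z Complex.I Complex.I) / 2 := by
  obtain ⟨h00, -, -, h11⟩ := shapeCoeff_toPlane (φ ∘ e.symm) (η ∘ e.symm) z
  rw [meanCurvature_eq he.mem_maximalAtlas hφ hη hz (he.metric_coordVec hφ hz), h00, h11]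

/-- In a flat chart, the second fundamental form is that of a circular cone. -/
theorem IsFlatChart.exists_hasConeForm (he : IsFlatChart φ η e) (hφ : IsSmoothImmersion φ)
    (hη : IsUnitNormal φ η) (hflat : ∀ p, gaussCurvature φ η p = 0)
    (hgrad : ∀ p, 0 < gradNorm φ (meanCurvature φ η) p) (hf : ∀ p, 0 < meanCurvature φ η p)
    (hQ : IsHolomorphicQ φ η) {z₁ : ℂ} (hz₁ : toPlane z₁ ∈ e.target) :
    ∃ (m : ℝ) (z₀ : ℂ), ∀ᶠ z in nhds z₁, z ≠ z₀ ∧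
      HasConeForm ((φ ∘ e.symm) ∘ toPlane) ((η ∘ e.symm) ∘ toPlane) m z₀ z := by
  have hP := he.isFlatPatch hφ hη
  refine hP.exists_hasConeForm ?_ ?_ ?_ hz₁ ?_
  · intro z hz
    obtain ⟨h00, h01, h10, h11⟩ := shapeCoeff_toPlane (φ ∘ e.symm) (η ∘ e.symm) z
    have h := det_shapeCoeff_eq_zero he.mem_maximalAtlas hφ hη hz (hflat _)
    rw [h00, h01, h10, h11, hP.secondCoeff_symm hz Complex.I 1] at h
    rw [h, sq]
  · intro z hz
    have h := hf (e.symm (toPlane z))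
    rw [he.meanCurvature_toPlane hφ hη hz] at h
    linarith
  · have h := hQ e (he.isIsothermal hφ)
    have hset : {z : ℂ | (!₂[z.re, z.im] : Plane) ∈ e.target} = toPlane ⁻¹' e.target := by
      ext z; rw [Set.mem_preimage, toPlane_apply]; rfl
    rw [hset] at h
    refine h.congr fun z hz => ?_
    obtain ⟨h00, h01, h10, h11⟩ := shapeCoeff_toPlane (φ ∘ e.symm) (η ∘ e.symm) z
    rw [hopfQ_eq he.mem_maximalAtlas hφ hη (by rw [← toPlane_apply]; exact hz), ← toPlane_apply,
      h00, h01, h10, h11, he.meanCurvature_toPlane hφ hη hz]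
  -- Local constancy of the trace in the chart would make `f` constant near the point of `M`, so its
  -- gradient would vanish there.
  · intro hev
    have hp := e.map_target hz₁
    have hgr := hgrad (e.symm (toPlane z₁))
    refine hgr.ne' (gradNorm_eq_zero ?_)
    have hct : Filter.Tendsto (fun q => toPlane.symm (e q)) (nhds (e.symm (toPlane z₁)))
        (nhds z₁) := by
      have h1 : ContinuousAt (fun q => toPlane.symm (e q)) (e.symm (toPlane z₁)) :=
        toPlane.symm.continuous.continuousAt.comp (e.continuousAt hp)
      have h2 : toPlane.symm (e (e.symm (toPlane z₁))) = z₁ := by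
        rw [e.right_inv hz₁, toPlane.symm_apply_apply]
      simpa only [ContinuousAt, h2] using h1
    have hcst : meanCurvature φ η =ᶠ[nhds (e.symm (toPlane z₁))]
        fun _ => meanCurvature φ η (e.symm (toPlane z₁)) := by
      filter_upwards [hct.eventually hev, e.open_source.mem_nhds hp] with q hq hqs
      have h3 : e.symm (toPlane (toPlane.symm (e q))) = q := by
        rw [toPlane.apply_symm_apply, e.left_inv hqs]
      have h4 : toPlane (toPlane.symm (e q)) ∈ e.target := by
        rw [toPlane.apply_symm_apply]; exact e.map_source hqs
      have h5 := he.meanCurvature_toPlane hφ hη h4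
      rw [h3, hq, ← he.meanCurvature_toPlane hφ hη hz₁] at h5
      exact h5
    rw [hcst.mfderiv_eq]
    exact mfderiv_const

theorem contDiff_unitVec : ContDiff ℝ ∞ unitVec := by
  rw [show unitVec = fun u : ℝ => ((Real.cos u : ℝ) : ℂ) + ((Real.sin u : ℝ) : ℂ) * Complex.I from
    funext unitVec_eq]
  exact (Complex.ofRealCLM.contDiff.comp Real.contDiff_cos).add
    ((Complex.ofRealCLM.contDiff.comp Real.contDiff_sin).mul contDiff_const)

/-- The change of variables from cone coordinates to flat coordinates. -/
noncomputable def coneCoord (z₀ : ℂ) (a : Plane) : Plane := toPlane (polarMap z₀ (a 0) (a 1 + 1))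

theorem contDiff_coneCoord (z₀ : ℂ) : ContDiff ℝ ∞ (coneCoord z₀) := by
  have h0 : ContDiff ℝ ∞ fun a : Plane => a 0 := (EuclideanSpace.proj 0 : Plane →L[ℝ] ℝ).contDiff
  have h1 : ContDiff ℝ ∞ fun a : Plane => a 1 := (EuclideanSpace.proj 1 : Plane →L[ℝ] ℝ).contDiff
  exact toPlane.toContinuousLinearEquiv.contDiff.comp (contDiff_const.add
    ((Complex.ofRealCLM.contDiff.comp (h1.add contDiff_const)).mul (contDiff_unitVec.comp h0)))

/-- Up to the unit factor `unitVec (a 0)`, the differential is `v ↦ r v₀ i + v₁` with `r = a 1 + 1`,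
so it is injective away from the vertex. -/
theorem injective_fderiv_coneCoord (z₀ : ℂ) {a : Plane} (ha : 0 < a 1 + 1) :
    Function.Injective (fderiv ℝ (coneCoord z₀) a) := by
  have h0 : HasFDerivAt (fun a : Plane => a 0) (EuclideanSpace.proj 0 : Plane →L[ℝ] ℝ) a :=
    (EuclideanSpace.proj 0 : Plane →L[ℝ] ℝ).hasFDerivAt
  have h1 : HasFDerivAt (fun a : Plane => a 1) (EuclideanSpace.proj 1 : Plane →L[ℝ] ℝ) a :=
    (EuclideanSpace.proj 1 : Plane →L[ℝ] ℝ).hasFDerivAt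
  have hc : HasFDerivAt (fun a : Plane => unitVec (a 0)) _ a :=
    HasFDerivAt.comp (g := unitVec) (f := fun a : Plane => a 0) a
      (hasDerivAt_unitVec (a 0)).hasFDerivAt h0
  have h2 : HasFDerivAt (fun a : Plane => z₀ + (a 1 + 1) • unitVec (a 0)) _ a :=
    ((h1.add_const 1).smul hc).const_add z₀
  have h3 : coneCoord z₀ = fun a : Plane => toPlane (z₀ + (a 1 + 1) • unitVec (a 0)) := by
    funext a; simp [coneCoord, polarMap]
  have h4 := ((toPlane.toContinuousLinearEquiv : ℂ →L[ℝ] Plane).hasFDerivAt.comp a h2).fderiv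
  rw [(congrArg (fun F => fderiv ℝ F a) h3).trans h4]
  refine (injective_iff_map_eq_zero (_ : Plane →L[ℝ] Plane)).2 fun v hv => ?_
  have h5 := toPlane.injective (hv.trans (map_zero toPlane).symm)
  have h6 : unitVec (a 0) * ((a 1 + 1) * v 0 * Complex.I + v 1) = 0 := by
    rw [← h5]; simp; ring
  have hu : unitVec (a 0) ≠ 0 := norm_ne_zero_iff.1 (by rw [norm_unitVec]; exact one_ne_zero)
  have h7 := (mul_eq_zero.1 h6).resolve_left hu
  have h8 := congrArg Complex.re h7
  have h9 := congrArg Complex.im h7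
  simp at h8 h9
  ext i
  fin_cases i
  · exact h9.resolve_left ha.ne'
  · exact h8

end Assembly

end FlatSurface

/-! ### The local classification -/

theorem mainTheorem6 {M : Type*} [TopologicalSpace M] [ChartedSpace FlatSurface.Plane M]
    [IsManifold (𝓡 2) ∞ M]
    (φ η : M → FlatSurface.Space)
    (hφ : FlatSurface.IsSmoothImmersion φ)
    (hη : FlatSurface.IsUnitNormal φ η)
    (hflat : ∀ p, FlatSurface.gaussCurvature φ η p = 0)
    (hgrad : ∀ p, 0 < FlatSurface.gradNorm φ (FlatSurface.meanCurvature φ η) p)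
    (hf : ∀ p, 0 < FlatSurface.meanCurvature φ η p)
    (hQ : FlatSurface.IsHolomorphicQ φ η) :
    ∀ p : M, ∃ α β k : ℝ, α ^ 2 + k ^ 2 * β ^ 2 = k ^ 2 ∧ α ≠ 0 ∧
      ∃ T : FlatSurface.Space ≃ᵃⁱ[ℝ] FlatSurface.Space,
      ∃ e ∈ IsManifold.maximalAtlas (𝓡 2) ∞ M, p ∈ e.source ∧
        ∀ a ∈ e.target, φ (e.symm a) = T (FlatSurface.cone α β k (a 0) (a 1)) := by
  open FlatSurface in
  intro p
  obtain ⟨e, he, hp⟩ := exists_isFlatChart hφ hη hflat p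
  set z₁ : ℂ := toPlane.symm (e p) with hz₁def
  have hz₁p : toPlane z₁ = e p := toPlane.apply_symm_apply _
  have hz₁ : toPlane z₁ ∈ e.target := by rw [hz₁p]; exact e.map_source hp
  obtain ⟨m, z₀, hev⟩ := he.exists_hasConeForm hφ hη hflat hgrad hf hQ hz₁
  have hP := he.isFlatPatch hφ hη
  obtain ⟨D, hD, hDo, hDz⟩ := eventually_nhds_iff.1
    (hev.and (hP.isOpen.mem_nhds (show z₁ ∈ toPlane ⁻¹' e.target from hz₁)))
  have hne : z₁ - z₀ ≠ 0 := sub_ne_zero.2 (hD z₁ hDz).1.1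
  have hpolar : polarMap z₀ (z₁ - z₀).arg ‖z₁ - z₀‖ = z₁ := by
    rw [polarMap, unitVec_eq]
    push_cast
    rw [Complex.norm_mul_cos_add_sin_mul_I]
    ring
  obtain ⟨α, β, k, hαβ, hα, T, δ, hδ, hT⟩ := (hP.mono hDo fun z hz => (hD z hz).2).exists_cone
    (fun z hz => (hD z hz).1.2) (norm_pos_iff.2 hne) (by rw [hpolar]; exact hDz)
  set U : Set Plane := {a | a 0 ∈ Metric.ball (z₁ - z₀).arg δ ∧
    a 1 + 1 ∈ Metric.ball ‖z₁ - z₀‖ δ} with hU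
  have hUo : IsOpen U :=
    (Metric.isOpen_ball.preimage (by fun_prop : Continuous fun a : Plane => a 0)).inter
      (Metric.isOpen_ball.preimage (by fun_prop : Continuous fun a : Plane => a 1 + 1))
  -- The base point is the polar angle and radius of `z₁` about `z₀`, with the radius lowered by 1
  -- because `v = r - 1`.
  obtain ⟨g, hg₀, hgU, hgΨ, hg, hg'⟩ := exists_localDiffeo (Φ := coneCoord z₀) hUo
    (contDiff_coneCoord z₀).contDiffOn
    (fun a ha => injective_fderiv_coneCoord z₀ (hT _ ha.1 _ ha.2).1)
    (a₀ := !₂[(z₁ - z₀).arg, ‖z₁ - z₀‖ - 1]) (by simp [hU, hδ])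
  have hg₀p : g !₂[(z₁ - z₀).arg, ‖z₁ - z₀‖ - 1] = e p := by
    rw [hgΨ, ← hz₁p, coneCoord]
    simp [hpolar]
  -- `g` goes from cone to Cartesian coordinates, so the required chart is the flat chart followed
  -- by its inverse.
  refine ⟨α, β, k, hαβ, hα, T, e.trans g.symm, trans_mem_maximalAtlas he.mem_maximalAtlas hg' hg,
    ?_, fun a ha => ?_⟩
  · rw [OpenPartialHomeomorph.trans_source]
    refine ⟨hp, ?_⟩
    change e p ∈ g.target
    rw [← hg₀p]
    exact g.map_source hg₀
  · rw [OpenPartialHomeomorph.trans_target] at ha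
    have haU := hgU ha.1
    have h1 := (hT _ haU.1 _ haU.2).2.2
    rw [add_sub_cancel_right] at h1
    rw [← h1]
    change φ (e.symm (g a)) = φ (e.symm (toPlane (polarMap z₀ (a 0) (a 1 + 1))))
    rw [hgΨ]
    rfl
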